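/- **Conventions.** Let $I,J\subset\mathbb N$ be finite sets with at least two elements each and $0\in I\cap J$; put $n=\max I$, $m=\max J$. Let $\mathbb K$ be an algebraically closed field of characteristic $p\ge 0$ with a nontrivial valuation $v:\mathbb K^*\to\mathbb R$ with image $\Gamma$, and let $T=-v$, $T(0)=-\infty$. A *resultant of supports $I,J$ over $\mathbb K$* is a polynomial $R=R(I,J,\mathbb K)\in(\mathbb Z/p\mathbb Z)[a_i,b_j: i\in I,\,j\in J]$ such that, for all values of the $a_i,b_j$ in $\mathbb K$ with $a_0a_nb_0b_m\ne 0$, $R(a,b)=0$ if and only if $\sum_{i\in I}a_ix^i$ and $\sum_{j\in J}b_jx^j$ have a common root in $\mathbb K$. (The determinant of the Sylvester matrix is one, as are its nonzero constant multiples.) Write $R=\sum_u c_u z^u$, where $z=(a,b)$ is the vector of the $N=|I|+|J|$ variables; its Newton polytope $\mathcal N(R)$ is the convex hull of $\{u: c_u\neq 0\}$ in $\mathbb R^N$. The tropical resultant is $R_t=\max_{u:\,c_u\ne0}\,(T(c_u)+\langle u,w\rangle)$, with $c_u$ seen in $\mathbb K$, and $\mathcal T(R_t)\subseteq\Gamma^N$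 is the set of $w\in\Gamma^N$ at which this maximum is attained for at least two exponents $u$. For $w\in\mathbb R^N$ let $\Lambda_w$ be the convex hull of the exponents attaining the maximum at $w$ (the cell dual to $w$ of the subdivision of $\mathcal N(R)$ induced by $R_t$). The cells of the polyhedral complex carried by the tropical hypersurface are the sets $\{w\in\mathbb R^N:\Lambda_{w_0}\subseteq\Lambda_w\}$, where $w_0\in\mathbb R^N$ is such that $\Lambda_{w_0}$ is not a point. The *fan dual to* a polytope $P$ is here the set of outer normal cones $\{w: F\subseteq \mathrm{face}_w(P)\}$ of the faces $F$ of $P$ of positive dimension, where $\mathrm{face}_w(P)$ is the face on which $\langle w,\cdot\rangle$ is maximal. **Statement.** The tropical hypersurface of the tropical resultant of supports $I,J$ does not depend on the field or its characteristic, only on $I$ and $J$: let $\mathbb K,\mathbb K'$ be two valued fields as above (possibly with different characteristics, residue characteristics and value groups) and let $R$, $R'$ be resultants of supports $I,J$ over $\mathbb K$, $\mathbb K'$. Then $R_t$ and $R'_t$ define the same polyhedral complex in $\mathbb R^N$, and $\mathcal T(R_t)$ and $\mathcal T(R'_t)$ have the same closure in $\mathbb R^N$. It is the polyhedral fan dual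 to the Newton polytope of the resultant: $\Lambda_w=\mathrm{face}_w(\mathcal N(R))$ for every $w\in\mathbb R^N$, the cells of the complex defined by $R_t$ are exactly the cones of the fan dual to $\mathcal N(R)$, $\mathcal T(R_t)$ is the set of the points of $\Gamma^N$ in the union of these cones, and the closure of $\mathcal T(R_t)$ in $\mathbb R^N$ is this union. -/

import Mathlib

namespace TropRes

/-! ### Max-plus tropical polynomials and their zero sets -/

/-- A tropical (max-plus) polynomial `"∑_{u ∈ support} coeff u * x ^ u"` in the variables `σ`, with
finite coefficients; a monomial outside `support` has coefficient `-∞`, and the values of `coeff`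
there are never used. -/
structure TropPoly (σ : Type*) where
  /-- The finite set of exponent vectors. -/
  support : Finset (σ →₀ ℕ)
  /-- The tropical coefficients. -/
  coeff : (σ →₀ ℕ) → ℝ

variable {σ : Type*} [Fintype σ]

namespace TropPoly

/-- The value `coeff u + ∑ s, u s * w s` at `w` of the tropical monomial with exponent `u`. -/
def term (f : TropPoly σ) (u : σ →₀ ℕ) (w : σ → ℝ) : ℝ :=
  f.coeff u + ∑ s, (u s : ℝ) * w s

/-- The exponents whose monomials attain the maximum defining `f` at `w`. -/
def maxTerms (f : TropPoly σ) (w : σ → ℝ) : Set (σ →₀ ℕ) :=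
  {u | u ∈ f.support ∧ ∀ u' ∈ f.support, f.term u' w ≤ f.term u w}

/-- The tropical hypersurface of `f` among the points with coordinates in `Γ`: the points at which
the maximum is attained for at least two different exponents. -/
def zeros (Γ : Set ℝ) (f : TropPoly σ) : Set (σ → ℝ) :=
  {w | (∀ s, w s ∈ Γ) ∧ (f.maxTerms w).Nontrivial}

end TropPoly

/-- An exponent vector as a point of real space. -/
def toReal (u : σ →₀ ℕ) : σ → ℝ := fun s => (u s : ℝ)

namespace TropPoly

/-- The cell, dual to the point `w`, of the regular subdivision of the Newton polytope that `f`
induces: the projection of the face with outer normal `(w, 1)` of the convex hull of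
`{(u, t) | u ∈ support, t ≤ coeff u}`. -/
def dualCell (f : TropPoly σ) (w : σ → ℝ) : Set (σ → ℝ) :=
  convexHull ℝ (toReal '' f.maxTerms w)

/-- The (closed) cells of the polyhedral complex in real space carried by the tropical hypersurface
of `f`. The cell through `w₀` consists of the points `w` whose dual cell has the dual cell
of `w₀` as a face. -/
def cells (f : TropPoly σ) : Set (Set (σ → ℝ)) :=
  {C | ∃ w₀ ∈ f.zeros Set.univ, C = {w | f.dualCell w₀ ⊆ f.dualCell w}}

end TropPoly

/-! ### Newton polytopes and their dual fans -/

/-- The Newton polytope of a polynomial. -/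
def newtonPolytope {A : Type*} [CommSemiring A] (R : MvPolynomial σ A) : Set (σ → ℝ) :=
  convexHull ℝ (toReal '' (R.support : Set (σ →₀ ℕ)))

/-- The face of `P` on which the linear functional `x ↦ ∑ s, w s * x s` is maximal. -/
def face (P : Set (σ → ℝ)) (w : σ → ℝ) : Set (σ → ℝ) :=
  {x | x ∈ P ∧ ∀ y ∈ P, ∑ s, w s * y s ≤ ∑ s, w s * x s}

/-- The polyhedral fan dual to a polytope `P`, without its full dimensional cones: the (outer)
normal cones of all the faces of `P` with more than one point. -/
def dualFan (P : Set (σ → ℝ)) : Set (Set (σ → ℝ)) :=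
  {C | ∃ w₀, (face P w₀).Nontrivial ∧ C = {w | face P w₀ ⊆ face P w}}

/-! ### Tropicalization -/

/-- The value group `Γ ⊆ ℝ` of a real valuation. -/
def valueGroup {K : Type*} [Field K] (v : AddValuation K (WithTop ℝ)) : Set ℝ :=
  {γ | ∃ x : K, v x = (γ : WithTop ℝ)}

/-- The tropicalization of a polynomial: every nonzero coefficient `c` is replaced with
`T(c) = -v(c)`. -/
noncomputable def tropicalize {K : Type*} [Field K] (v : AddValuation K (WithTop ℝ))
    (F : MvPolynomial σ K) : TropPoly σ where
  support := F.support
  coeff u := -(v (F.coeff u)).untopD 0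

/-! ### Resultants of univariate polynomials with given supports -/

/-- `R`, a polynomial over the prime ring `ℤ/p` (which is `ℤ` for `p = 0`) in the indeterminate
coefficients `a_i` (`i ∈ I`) and `b_j` (`j ∈ J`), is a resultant of supports `I`, `J` over a field
`K` of characteristic `p`: whenever the extreme coefficients
`a_0`, `a_{max I}`, `b_0`, `b_{max J}` are nonzero, it vanishes at `(a, b)` if and only if
`∑ a_i x ^ i` and `∑ b_j x ^ j` have a common root in `K`. -/
def IsResultant (K : Type*) [Field K] (p : ℕ) [CharP K p] (I J : Finset ℕ)
    (R : MvPolynomial (I ⊕ J) (ZMod p)) : Prop :=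
  ∀ (a : I → K) (b : J → K),
    (∀ i : I, ((i : ℕ) = 0 ∨ (i : ℕ) = I.sup id) → a i ≠ 0) →
    (∀ j : J, ((j : ℕ) = 0 ∨ (j : ℕ) = J.sup id) → b j ≠ 0) →
    (MvPolynomial.eval₂ (ZMod.castHom (dvd_refl p) K) (Sum.elim a b) R = 0 ↔
      ∃ x : K, ∑ i : I, a i * x ^ (i : ℕ) = 0 ∧ ∑ j : J, b j * x ^ (j : ℕ) = 0)

/-- The tropical resultant `R_t` of a resultant `R` over `K`: the tropicalization of `R`, seen as a
polynomial over the valued field `K`. -/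
noncomputable def tropicalResultant {K : Type*} [Field K] (p : ℕ) [CharP K p]
    (v : AddValuation K (WithTop ℝ)) {I J : Finset ℕ}
    (R : MvPolynomial (I ⊕ J) (ZMod p)) : TropPoly (I ⊕ J) :=
  tropicalize v (MvPolynomial.map (ZMod.castHom (dvd_refl p) K) R)

open Polynomial in
/-- Resultants exist: the determinant of the Sylvester matrix of the two polynomials with
indeterminate coefficients is one. -/
theorem isResultant_resultant (K : Type*) [Field K] [IsAlgClosed K] (p : ℕ) [CharP K p]
    (I J : Finset ℕ) (hI : 2 ≤ I.card) (hJ : 2 ≤ J.card) :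
    IsResultant K p I J
      (Polynomial.resultant
        (∑ i : I, C (MvPolynomial.X (Sum.inl i) : MvPolynomial (I ⊕ J) (ZMod p)) * X ^ (i : ℕ))
        (∑ j : J, C (MvPolynomial.X (Sum.inr j) : MvPolynomial (I ⊕ J) (ZMod p)) * X ^ (j : ℕ))
        (I.sup id) (J.sup id)) := by
  have key : ∀ (I : Finset ℕ), 2 ≤ I.card → ∀ a : I → K,
      (∀ i : I, ((i : ℕ) = 0 ∨ (i : ℕ) = I.sup id) → a i ≠ 0) →
      (∑ i : I, C (a i) * X ^ (i : ℕ)).natDegree = I.sup id ∧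
      (∑ i : I, C (a i) * X ^ (i : ℕ)) ≠ 0 := by
    intro I hI a ha
    have hne : I.Nonempty := Finset.card_pos.mp (by omega)
    obtain ⟨m, hm, hmax⟩ := Finset.exists_mem_eq_sup I hne id
    have hc : (∑ i : I, C (a i) * X ^ (i : ℕ)).coeff (I.sup id) ≠ 0 := by
      rw [finsetSum_coeff, Finset.sum_eq_single ⟨m, hm⟩]
      · simp only [coeff_C_mul, coeff_X_pow, hmax, id]
        simpa using ha ⟨m, hm⟩ (Or.inr hmax.symm)
      · intro b _ hb
        have : I.sup id ≠ b := by
          intro h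
          apply hb
          ext
          simpa [hmax] using h.symm
        simp [coeff_X_pow, this]
      · simp
    refine ⟨le_antisymm ?_ (le_natDegree_of_ne_zero hc), fun h => hc (by rw [h, coeff_zero])⟩
    refine natDegree_sum_le_of_forall_le _ _ fun i _ => ?_
    exact (natDegree_C_mul_X_pow_le _ _).trans (Finset.le_sup (f := id) i.2)
  intro a b ha hb
  obtain ⟨hf, hf0⟩ := key I hI a ha
  obtain ⟨hg, hg0⟩ := key J hJ b hb
  have hmapF : (∑ i : I, C (MvPolynomial.X (Sum.inl i) : MvPolynomial (I ⊕ J) (ZMod p)) *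
      X ^ (i : ℕ)).map (MvPolynomial.eval₂Hom (ZMod.castHom (dvd_refl p) K) (Sum.elim a b)) =
      ∑ i : I, C (a i) * X ^ (i : ℕ) := by
    simp [Polynomial.map_sum]
  have hmapG : (∑ j : J, C (MvPolynomial.X (Sum.inr j) : MvPolynomial (I ⊕ J) (ZMod p)) *
      X ^ (j : ℕ)).map (MvPolynomial.eval₂Hom (ZMod.castHom (dvd_refl p) K) (Sum.elim a b)) =
      ∑ j : J, C (b j) * X ^ (j : ℕ) := by
    simp [Polynomial.map_sum]
  rw [← MvPolynomial.coe_eval₂Hom, ← Polynomial.resultant_map_map, hmapF, hmapG]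
  have e1 : ∀ x, ∑ i : I, a i * x ^ (i : ℕ) = (∑ i : I, C (a i) * X ^ (i : ℕ)).eval x := by
    intro x; simp [eval_finsetSum]
  have e2 : ∀ x, ∑ j : J, b j * x ^ (j : ℕ) = (∑ j : J, C (b j) * X ^ (j : ℕ)).eval x := by
    intro x; simp [eval_finsetSum]
  simp only [e1, e2]
  rw [← hf, ← hg, Polynomial.resultant_eq_zero_iff,
    Polynomial.isCoprime_iff_aeval_ne_zero_of_isAlgClosed K K]
  simp only [coe_aeval_eq_eval, hf0, ne_eq, not_false_eq_true, true_or, true_and, not_forall,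
    not_or, not_not]

end TropRes

namespace TropRes

/-! ### Values of a real valuation on a field -/

section Valuation

variable {K : Type*} [Field K] (v : AddValuation K (WithTop ℝ))

/-! The real tropical hypersurface of `R_t` is shown to equal `commonRootLocus I J`, a closed cone
defined without reference to a field. Over the value group Γ this is a lifting argument. By
Kapranov's theorem (`exists_eval_eq_zero_of_mem_zeros`) a tropical zero lifts to a zero of `R` with
nonzero coordinates, hence to two polynomials with a common root, and that root tropicalizes.
Conversely a common tropical root lies in Γ, since Γ is divisible, and `exists_lift_of_isTropRoot`
lifts the coefficients so that a prescribed lift of it becomes a root of both polynomials.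
Divisibility and density of Γ carry the equality over to real points: each of the two sets is the
closure of its Γ-points (`zeros_univ_subset_closure`, `commonRootLocus_subset_closure`).

A hypersurface that is a cone leaves the coefficients little freedom. Away from it one monomial
dominates a whole open ray; the start of the ray shows that its coefficient is maximal, the far end
that its exponent maximizes the linear form (`exists_mem_maxTerms_zero`). So maximal terms are those
maximizing both, and dual cells are faces of the Newton polytope. Coefficients whose tropicalization
drops, as residue characteristic allows, play no role.

The Newton polytopes of `R` and `R'` may differ, for instance by powers or monomial factors.
Independence of the field is therefore obtained by recovering the cells from the underlying set
alone (`dualCell_subset_iff_segments`). -/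

/-- The tropicalization `-v x` of an element, with the junk value `0` at `x = 0`. -/
noncomputable def trop (x : K) : ℝ := -(v x).untopD 0

theorem val_eq_coe {x : K} (hx : x ≠ 0) : v x = ((-trop v x : ℝ) : WithTop ℝ) := by
  have h : v x ≠ ⊤ := fun h => hx ((AddValuation.top_iff v).1 h)
  obtain ⟨r, hr⟩ := WithTop.ne_top_iff_exists.1 h
  simp [trop, ← hr]

theorem trop_eq_of_val {x : K} {r : ℝ} (h : v x = ((-r : ℝ) : WithTop ℝ)) : trop v x = r := by
  rw [trop, h, WithTop.untopD_coe, neg_neg]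

theorem ne_zero_of_val {x : K} {r : ℝ} (h : v x = (r : WithTop ℝ)) : x ≠ 0 := by
  rintro rfl
  simp at h

theorem trop_le_trop_iff {x y : K} (hx : x ≠ 0) (hy : y ≠ 0) :
    trop v x ≤ trop v y ↔ v y ≤ v x := by
  rw [val_eq_coe v hx, val_eq_coe v hy, WithTop.coe_le_coe, neg_le_neg_iff]

theorem trop_mul {x y : K} (hx : x ≠ 0) (hy : y ≠ 0) :
    trop v (x * y) = trop v x + trop v y := by
  apply trop_eq_of_val
  rw [AddValuation.map_mul, val_eq_coe v hx, val_eq_coe v hy, ← WithTop.coe_add, neg_add]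

theorem trop_one : trop v 1 = 0 := by simp [trop]

theorem trop_pow {x : K} (hx : x ≠ 0) (n : ℕ) : trop v (x ^ n) = n * trop v x := by
  induction n with
  | zero => simp [trop_one]
  | succ n ih => rw [pow_succ, trop_mul v (pow_ne_zero _ hx) hx, ih]; push_cast; ring

theorem trop_prod {ι : Type*} (s : Finset ι) (x : ι → K) (hx : ∀ i ∈ s, x i ≠ 0) :
    trop v (∏ i ∈ s, x i) = ∑ i ∈ s, trop v (x i) := by
  classical
  induction s using Finset.induction_on with
  | empty => simp [trop_one]
  | insert a s ha ih =>
    have hs : ∀ i ∈ s, x i ≠ 0 := fun i hi => hx i (Finset.mem_insert_of_mem hi)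
    rw [Finset.prod_insert ha, Finset.sum_insert ha,
      trop_mul v (hx a (Finset.mem_insert_self a s)) (Finset.prod_ne_zero_iff.2 hs), ih hs]

theorem trop_inv {x : K} (hx : x ≠ 0) : trop v x⁻¹ = -trop v x := by
  have h := trop_mul v hx (inv_ne_zero hx)
  rw [mul_inv_cancel₀ hx, trop_one] at h
  linarith

theorem trop_neg (x : K) : trop v (-x) = trop v x := by simp [trop]

theorem mem_valueGroup_iff {γ : ℝ} : γ ∈ valueGroup v ↔ ∃ x : K, x ≠ 0 ∧ trop v x = γ := by
  constructor
  · rintro ⟨x, hx⟩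
    have h0 := ne_zero_of_val v hx
    refine ⟨x⁻¹, inv_ne_zero h0, ?_⟩
    rw [trop_inv v h0, trop_eq_of_val v (r := -γ) (by simpa using hx), neg_neg]
  · rintro ⟨x, hx, rfl⟩
    refine ⟨x⁻¹, ?_⟩
    rw [val_eq_coe v (inv_ne_zero hx), trop_inv v hx, neg_neg]

/-- The value group as a subgroup of the real numbers. -/
def valueSubgroup : AddSubgroup ℝ where
  carrier := valueGroup v
  zero_mem' := (mem_valueGroup_iff v).2 ⟨1, one_ne_zero, trop_one v⟩
  add_mem' := by
    intro a b ha hb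
    obtain ⟨x, hx, rfl⟩ := (mem_valueGroup_iff v).1 ha
    obtain ⟨y, hy, rfl⟩ := (mem_valueGroup_iff v).1 hb
    exact (mem_valueGroup_iff v).2 ⟨x * y, mul_ne_zero hx hy, trop_mul v hx hy⟩
  neg_mem' := by
    intro a ha
    obtain ⟨x, hx, rfl⟩ := (mem_valueGroup_iff v).1 ha
    exact (mem_valueGroup_iff v).2 ⟨x⁻¹, inv_ne_zero hx, trop_inv v hx⟩

theorem mem_valueSubgroup_iff {γ : ℝ} : γ ∈ valueSubgroup v ↔ ∃ x : K, x ≠ 0 ∧ trop v x = γ :=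
  mem_valueGroup_iff v

theorem div_mem_valueSubgroup [IsAlgClosed K] {γ : ℝ} (hγ : γ ∈ valueSubgroup v) (n : ℤ) :
    γ / n ∈ valueSubgroup v := by
  have key : ∀ n : ℕ, γ / n ∈ valueSubgroup v := by
    intro n
    rcases Nat.eq_zero_or_pos n with rfl | hn
    -- Real division by zero gives zero, which lies in the group.
    · simp [(valueSubgroup v).zero_mem]
    obtain ⟨x, hx, rfl⟩ := (mem_valueSubgroup_iff v).1 hγ
    obtain ⟨z, rfl⟩ := IsAlgClosed.exists_pow_nat_eq x hn
    have hz : z ≠ 0 := by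
      rintro rfl
      exact hx (zero_pow hn.ne')
    refine (mem_valueSubgroup_iff v).2 ⟨z, hz, ?_⟩
    rw [trop_pow v hz]
    field_simp
  obtain ⟨m, rfl | rfl⟩ := n.eq_nat_or_neg
  · exact_mod_cast key m
  · have := (valueSubgroup v).neg_mem (key m)
    push_cast
    rwa [div_neg]

theorem dense_valueSubgroup [IsAlgClosed K] (hv : ∃ x : K, x ≠ 0 ∧ v x ≠ 0) :
    Dense (valueSubgroup v : Set ℝ) := by
  obtain ⟨x, hx, hvx⟩ := hv
  have hγ : trop v x ≠ 0 := by
    intro h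
    rw [val_eq_coe v hx, h] at hvx
    simp at hvx
  have hmem : |trop v x| ∈ valueSubgroup v := by
    have h := (mem_valueSubgroup_iff v).2 ⟨x, hx, rfl⟩
    rcases abs_choice (trop v x) with h' | h' <;> rw [h']
    · exact h
    · exact neg_mem h
  have hpos : 0 < |trop v x| := abs_pos.2 hγ
  refine AddSubgroup.dense_of_not_isolated_zero _ fun ε hε => ?_
  obtain ⟨n, hn⟩ := exists_nat_gt (|trop v x| / ε)
  have hn0 : (0 : ℝ) < n := lt_trans (by positivity) hn
  refine ⟨|trop v x| / n, ?_, by positivity, ?_⟩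
  · exact_mod_cast div_mem_valueSubgroup v hmem n
  · rw [div_lt_iff₀ hε] at hn
    rw [div_lt_iff₀ hn0]
    linarith

/-- If a finite sum with a nonzero term vanishes, its largest terms come at least in pairs. -/
theorem exists_ne_max_of_sum_eq_zero {ι : Type*} (s : Finset ι) (x : ι → K)
    (hx : ∃ i ∈ s, x i ≠ 0) (hsum : ∑ i ∈ s, x i = 0) :
    ∃ i ∈ s, ∃ j ∈ s, i ≠ j ∧ x i ≠ 0 ∧ x j ≠ 0 ∧
      ∀ k ∈ s, x k ≠ 0 → trop v (x k) ≤ trop v (x i) ∧ trop v (x k) ≤ trop v (x j) := by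
  classical
  obtain ⟨i₀, hi₀, hx₀⟩ := hx
  obtain ⟨i, hi, hmin⟩ := s.exists_min_image (fun i => v (x i)) ⟨i₀, hi₀⟩
  have hxi : x i ≠ 0 := by
    intro h
    have := hmin i₀ hi₀
    rw [h, AddValuation.map_zero, top_le_iff, AddValuation.top_iff] at this
    exact hx₀ this
  by_cases hex : ∃ j ∈ s, i ≠ j ∧ v (x j) ≤ v (x i)
  · obtain ⟨j, hj, hij, hle⟩ := hex
    have hxj : x j ≠ 0 := by
      intro h
      rw [h, AddValuation.map_zero, top_le_iff, AddValuation.top_iff] at hle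
      exact hxi hle
    refine ⟨i, hi, j, hj, hij, hxi, hxj, fun k hk hxk => ?_⟩
    exact ⟨(trop_le_trop_iff v hxk hxi).2 (hmin k hk),
      (trop_le_trop_iff v hxk hxj).2 (hle.trans (hmin k hk))⟩
  · push Not at hex
    exfalso
    have h1 : v (x i) < v (∑ j ∈ s.erase i, x j) := by
      refine AddValuation.map_lt_sum v (fun h => hxi ((AddValuation.top_iff v).1 h)) ?_
      intro j hj
      exact hex j (Finset.mem_of_mem_erase hj) (Finset.ne_of_mem_erase hj).symm
    rw [← Finset.add_sum_erase s x hi] at hsum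
    rw [← neg_eq_of_add_eq_zero_right hsum, AddValuation.map_neg] at h1
    exact lt_irrefl _ h1

/-- Rescaling by a unit avoids cancellation. If `y + s` cancels, it suffices that `c` and `1 - c`
are both units, because `c * y + s = -((1 - c) * y) + (y + s)`. -/
theorem exists_val_eq_val_mul_add [IsAlgClosed K] {y s : K} (hs : v y ≤ v s) :
    ∃ c : K, v c = 0 ∧ v (c * y + s) = v y := by
  by_cases h : v (y + s) = v y
  · exact ⟨1, by simp, by simpa using h⟩
  have hlt : v y < v (y + s) := lt_of_le_of_ne (by
    have := AddValuation.map_add v y s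
    rwa [min_eq_left hs] at this) (Ne.symm h)
  -- A root of `X ^ 2 - X + 1` satisfies `c * (1 - c) = 1` and `c ^ 2 = -(1 - c)`, so `c` and `1 -
  -- c` have valuation zero in every characteristic and residue characteristic.
  have hdeg : (Polynomial.X ^ 2 - Polynomial.X + Polynomial.C (1 : K)).degree = 2 := by
    compute_degree!
  obtain ⟨c, hc⟩ := IsAlgClosed.exists_root (Polynomial.X ^ 2 - Polynomial.X + Polynomial.C (1 : K))
    (by rw [hdeg]; decide)
  have hc : c ^ 2 - c + 1 = 0 := by simpa using hc
  have hc0 : c ≠ 0 := by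
    rintro rfl
    norm_num at hc
  have hmul : c * (1 - c) = 1 := by linear_combination -hc
  have hc1 : 1 - c ≠ 0 := by
    intro h
    rw [h, mul_zero] at hmul
    exact zero_ne_one hmul
  have hsum : trop v c + trop v (1 - c) = 0 := by
    rw [← trop_mul v hc0 hc1, hmul, trop_one]
  have hle : trop v c ≤ 0 := by
    have h3 : c ^ 2 = -(1 - c) := by linear_combination hc
    have h4 := congrArg (trop v) h3
    rw [trop_pow v hc0, trop_neg] at h4
    push_cast at h4
    linarith
  have hle' : trop v (1 - c) ≤ 0 := by
    have h3 : (1 - c) ^ 2 = -c := by linear_combination hc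
    have h4 := congrArg (trop v) h3
    rw [trop_pow v hc1, trop_neg] at h4
    push_cast at h4
    linarith
  have hvc : v c = 0 := by
    rw [val_eq_coe v hc0, show trop v c = 0 by linarith]; simp
  have hvc1 : v (1 - c) = 0 := by
    rw [val_eq_coe v hc1, show trop v (1 - c) = 0 by linarith]; simp
  refine ⟨c, hvc, ?_⟩
  have h5 : c * y + s = -((1 - c) * y) + (y + s) := by ring
  have h6 : v (-((1 - c) * y)) = v y := by
    rw [AddValuation.map_neg, AddValuation.map_mul, hvc1, zero_add]
  rw [h5, AddValuation.map_add_eq_of_lt_left v (by rwa [h6]), h6]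

/-- A polynomial without roots of valuation zero has a unique coefficient of least valuation. -/
theorem exists_unique_min_coeff [IsAlgClosed K] (q : Polynomial K) (hq : q ≠ 0)
    (hroot : ∀ r : K, v r = 0 → q.eval r ≠ 0) :
    ∃ j, ∀ k, k ≠ j → v (q.coeff j) < v (q.coeff k) := by
  induction hn : q.natDegree generalizing q with
  | zero =>
    obtain ⟨c, rfl⟩ := Polynomial.natDegree_eq_zero.1 hn
    refine ⟨0, fun k hk => ?_⟩
    have hc : c ≠ 0 := by
      rintro rfl
      simp at hq
    rw [Polynomial.coeff_C_zero, Polynomial.coeff_C_of_ne_zero hk, val_eq_coe v hc,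
      AddValuation.map_zero]
    exact WithTop.coe_lt_top _
  | succ n ih =>
    obtain ⟨r, hr⟩ := IsAlgClosed.exists_root q (by
      intro h
      rw [Polynomial.natDegree_eq_zero_iff_degree_le_zero.2 h.le] at hn
      omega)
    obtain ⟨q', rfl⟩ := Polynomial.dvd_iff_isRoot.2 hr
    have hq' : q' ≠ 0 := right_ne_zero_of_mul hq
    have hdeg : q'.natDegree = n := by
      rw [Polynomial.natDegree_mul (Polynomial.X_sub_C_ne_zero r) hq',
        Polynomial.natDegree_X_sub_C] at hn
      omega
    obtain ⟨j, hj⟩ := ih q' hq' (fun s hs h => hroot s hs (by simp [h])) hdeg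
    have hvj : v (q'.coeff j) ≠ ⊤ := (hj (j + 1) (by omega)).ne_top
    have hle : ∀ k, v (q'.coeff j) ≤ v (q'.coeff k) := fun k => by
      by_cases h : k = j
      · rw [h]
      · exact (hj k h).le
    have hr0 : v r ≠ 0 := fun h => hroot r h (by simp)
    have hc0 : ((Polynomial.X - Polynomial.C r) * q').coeff 0 = -(r * q'.coeff 0) := by
      simp [sub_mul]
    have hcs : ∀ k, ((Polynomial.X - Polynomial.C r) * q').coeff (k + 1) =
        q'.coeff k - r * q'.coeff (k + 1) := fun k => by
      simp [sub_mul]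
    -- In the factor `X - r` the constant term dominates if `v r < 0`, and the index of the minimum
    -- stays; otherwise `X` dominates and the index moves up by one.
    rcases lt_or_gt_of_ne hr0 with hneg | hpos
    · have hlt : v r + v (q'.coeff j) < v (q'.coeff j) := by
        obtain ⟨a, ha⟩ := WithTop.ne_top_iff_exists.1 hvj
        obtain ⟨b, hb⟩ := WithTop.ne_top_iff_exists.1 hneg.ne_top
        have hb0 : b < 0 := by
          rw [← hb] at hneg
          exact_mod_cast hneg
        rw [← ha, ← hb]
        exact_mod_cast (by linarith : b + a < a)
      have hmul : ∀ k, k ≠ j → v r + v (q'.coeff j) < v (r * q'.coeff k) := fun k hk => by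
        rw [AddValuation.map_mul]
        exact (WithTop.add_lt_add_iff_left hneg.ne_top).2 (hj k hk)
      have hval : v (((Polynomial.X - Polynomial.C r) * q').coeff j) =
          v r + v (q'.coeff j) := by
        rw [← AddValuation.map_mul] at hlt ⊢
        cases j with
        | zero => rw [hc0, AddValuation.map_neg]
        | succ j =>
          rw [hcs]
          exact AddValuation.map_sub_eq_of_lt_right v (hlt.trans_le (hle j))
      refine ⟨j, fun k hk => ?_⟩
      rw [hval]
      cases k with
      | zero => rw [hc0, AddValuation.map_neg]; exact hmul 0 hk
      | succ k =>
        rw [hcs]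
        exact lt_of_lt_of_le (lt_min (hlt.trans_le (hle k)) (hmul _ hk))
          (AddValuation.map_sub v _ _)
    · have hmul : ∀ k, v (q'.coeff j) < v (r * q'.coeff k) := fun k => by
        rw [AddValuation.map_mul]
        refine lt_of_lt_of_le ?_ (add_le_add_right (hle k) _)
        have := (WithTop.add_lt_add_iff_right hvj).2 hpos
        rwa [zero_add] at this
      have hval : v (((Polynomial.X - Polynomial.C r) * q').coeff (j + 1)) =
          v (q'.coeff j) := by
        rw [hcs]
        exact AddValuation.map_sub_eq_of_lt_left v (hmul _)
      refine ⟨j + 1, fun k hk => ?_⟩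
      rw [hval]
      cases k with
      | zero => rw [hc0, AddValuation.map_neg]; exact hmul 0
      | succ k =>
        rw [hcs]
        exact lt_of_lt_of_le (lt_min (hj k (by omega)) (hmul _)) (AddValuation.map_sub v _ _)

end Valuation

/-! ### Kapranov's theorem for hypersurfaces -/

/-- Finitely many exponent vectors are separated by a linear form with natural coefficients. -/
theorem exists_injOn_linear_form {σ : Type*} [Fintype σ] (S : Finset (σ →₀ ℕ)) :
    ∃ e : σ → ℕ, Set.InjOn (fun u : σ →₀ ℕ => ∑ s, u s * e s) S := by
  obtain ⟨m, hm⟩ : ∃ m : ℕ, ∀ u ∈ S, ∀ s, u s < m := by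
    refine ⟨(S.sup fun u => Finset.univ.sup fun s => u s) + 1, fun u hu s => ?_⟩
    refine Nat.lt_succ_of_le ?_
    exact (Finset.le_sup (f := fun s => u s) (Finset.mem_univ s)).trans
      (Finset.le_sup (f := fun u : σ →₀ ℕ => Finset.univ.sup fun s => u s) hu)
  let E := Fintype.equivFin σ
  -- With powers of `m` as weights, the exponents are the base `m` digits of the value of the form.
  have hrepr : ∀ u (hu : u ∈ S), ∑ s, u s * m ^ (E s : ℕ) =
      finFunctionFinEquiv (fun i => (⟨u (E.symm i), hm u hu _⟩ : Fin m)) := by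
    intro u hu
    rw [finFunctionFinEquiv_apply]
    exact Fintype.sum_equiv E _ _ fun s => by simp
  refine ⟨fun s => m ^ (E s : ℕ), fun u hu u' hu' h => ?_⟩
  simp only [hrepr u hu, hrepr u' hu'] at h
  have h1 := finFunctionFinEquiv.injective (Fin.ext h)
  ext s
  simpa using congrFun h1 (E s)

section Kapranov

variable {K : Type*} [Field K] (v : AddValuation K (WithTop ℝ)) {σ : Type*} [Fintype σ]

theorem tropicalize_term_eq (F : MvPolynomial σ K) {u : σ →₀ ℕ} (hu : u ∈ F.support)
    {z : σ → K} (hz : ∀ s, z s ≠ 0) :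
    (tropicalize v F).term u (fun s => trop v (z s)) =
      trop v (F.coeff u * ∏ s, z s ^ u s) := by
  rw [trop_mul v (MvPolynomial.mem_support_iff.1 hu)
    (Finset.prod_ne_zero_iff.2 fun s _ => pow_ne_zero _ (hz s)),
    trop_prod v _ _ fun s _ => pow_ne_zero _ (hz s)]
  simp only [trop_pow v (hz _)]
  rfl

theorem trop_mem_zeros_of_eval_eq_zero {F : MvPolynomial σ K} (hF : F ≠ 0) {z : σ → K}
    (hz : ∀ s, z s ≠ 0) (h : MvPolynomial.eval z F = 0) :
    (fun s => trop v (z s)) ∈ (tropicalize v F).zeros (valueGroup v) := by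
  refine ⟨fun s => (mem_valueGroup_iff v).2 ⟨z s, hz s, rfl⟩, ?_⟩
  rw [MvPolynomial.eval_eq'] at h
  have hne : ∀ u ∈ F.support, F.coeff u * ∏ s, z s ^ u s ≠ 0 := fun u hu =>
    mul_ne_zero (MvPolynomial.mem_support_iff.1 hu)
      (Finset.prod_ne_zero_iff.2 fun s _ => pow_ne_zero _ (hz s))
  obtain ⟨u₀, hu₀⟩ := MvPolynomial.support_nonempty.2 hF
  obtain ⟨i, hi, j, hj, hij, -, -, hmax⟩ :=
    exists_ne_max_of_sum_eq_zero v _ _ ⟨u₀, hu₀, hne u₀ hu₀⟩ h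
  refine ⟨i, ⟨hi, fun u hu => ?_⟩, j, ⟨hj, fun u hu => ?_⟩, hij⟩
  · rw [tropicalize_term_eq v F hu hz, tropicalize_term_eq v F hi hz]
    exact (hmax u hu (hne u hu)).1
  · rw [tropicalize_term_eq v F hu hz, tropicalize_term_eq v F hj hz]
    exact (hmax u hu (hne u hu)).2

/-- Every point of the tropical hypersurface over the value group lifts to a zero. -/
theorem exists_eval_eq_zero_of_mem_zeros [IsAlgClosed K] {F : MvPolynomial σ K} {w : σ → ℝ}
    (hw : w ∈ (tropicalize v F).zeros (valueGroup v)) :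
    ∃ z : σ → K, (∀ s, z s ≠ 0) ∧ (∀ s, trop v (z s) = w s) ∧ MvPolynomial.eval z F = 0 := by
  classical
  obtain ⟨hΓ, u₁, ⟨hu₁, hmax₁⟩, u₂, ⟨hu₂, hmax₂⟩, hne⟩ := hw
  choose ζ hζ0 hζ using fun s => (mem_valueGroup_iff v).1 (hΓ s)
  obtain rfl : (fun s => trop v (ζ s)) = w := funext hζ
  obtain ⟨e, he⟩ := exists_injOn_linear_form F.support
  -- This is `F` restricted to the curve `r ↦ (ζ s * r ^ e s)`. Distinct monomials give distinct
  -- powers of `r`, so nothing merges, and a root of valuation zero leaves the tropical point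
  -- unchanged.
  let q : Polynomial K := ∑ u ∈ F.support,
    Polynomial.monomial (∑ s, u s * e s) (F.coeff u * ∏ s, ζ s ^ u s)
  have hne0 : ∀ u ∈ F.support, F.coeff u * ∏ s, ζ s ^ u s ≠ 0 := fun u hu =>
    mul_ne_zero (MvPolynomial.mem_support_iff.1 hu)
      (Finset.prod_ne_zero_iff.2 fun s _ => pow_ne_zero _ (hζ0 s))
  have hcoeff : ∀ u ∈ F.support, q.coeff (∑ s, u s * e s) = F.coeff u * ∏ s, ζ s ^ u s := by
    intro u hu
    rw [Polynomial.finsetSum_coeff, Finset.sum_eq_single u]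
    · simp
    · intro u' hu' h
      rw [Polynomial.coeff_monomial, if_neg]
      exact fun h' => h (he hu' hu h')
    · exact fun h => absurd hu h
  have hcoeff' : ∀ k, q.coeff k = 0 ∨ ∃ u ∈ F.support, k = ∑ s, u s * e s := by
    intro k
    by_cases h : ∃ u ∈ F.support, k = ∑ s, u s * e s
    · exact Or.inr h
    · left
      rw [Polynomial.finsetSum_coeff]
      refine Finset.sum_eq_zero fun u hu => ?_
      rw [Polynomial.coeff_monomial, if_neg]
      exact fun h' => h ⟨u, hu, h'.symm⟩
  have hmin : ∀ u ∈ F.support, (∀ u' ∈ F.support,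
      (tropicalize v F).term u' (fun s => trop v (ζ s)) ≤
        (tropicalize v F).term u (fun s => trop v (ζ s))) →
      ∀ k, v (q.coeff (∑ s, u s * e s)) ≤ v (q.coeff k) := by
    intro u hu hmax k
    rcases hcoeff' k with h | ⟨u', hu', rfl⟩
    · rw [h, AddValuation.map_zero]
      exact le_top
    · have := hmax u' hu'
      rw [tropicalize_term_eq v F hu hζ0, tropicalize_term_eq v F hu' hζ0,
        trop_le_trop_iff v (hne0 u' hu') (hne0 u hu)] at this
      rwa [hcoeff u hu, hcoeff u' hu']
  have hq0 : q ≠ 0 := by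
    intro h
    have := hcoeff u₁ hu₁
    rw [h, Polynomial.coeff_zero] at this
    exact hne0 u₁ hu₁ this.symm
  -- Without such a root one coefficient would have strictly least valuation, but those of `u₁` and
  -- `u₂` tie for it.
  have hroot : ∃ r : K, v r = 0 ∧ q.eval r = 0 := by
    by_contra hcon
    push Not at hcon
    obtain ⟨j, hj⟩ := exists_unique_min_coeff v q hq0 hcon
    have hj₁ : ∑ s, u₁ s * e s = j := by
      by_contra h
      exact absurd (hj _ h) (not_lt.2 (hmin u₁ hu₁ hmax₁ j))
    have hj₂ : ∑ s, u₂ s * e s = j := by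
      by_contra h
      exact absurd (hj _ h) (not_lt.2 (hmin u₂ hu₂ hmax₂ j))
    exact hne (he hu₁ hu₂ (hj₁.trans hj₂.symm))
  obtain ⟨r, hr, hqr⟩ := hroot
  have hr0 : r ≠ 0 := ne_zero_of_val v (r := 0) (by simpa using hr)
  have htr : trop v r = 0 := trop_eq_of_val v (by simpa using hr)
  refine ⟨fun s => ζ s * r ^ e s, fun s => mul_ne_zero (hζ0 s) (pow_ne_zero _ hr0),
    fun s => ?_, ?_⟩
  · rw [trop_mul v (hζ0 s) (pow_ne_zero _ hr0), trop_pow v hr0, htr, mul_zero, add_zero]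
  · rw [← hqr, MvPolynomial.eval_eq', Polynomial.eval_finsetSum]
    refine Finset.sum_congr rfl fun u _ => ?_
    simp only [Polynomial.eval_monomial, mul_pow, Finset.prod_mul_distrib, ← pow_mul,
      Finset.prod_pow_eq_pow_sum, mul_comm (e _), mul_assoc]

end Kapranov

end TropRes

namespace TropRes

open Filter Topology

variable {σ : Type*} [Fintype σ]

/-! ### Elementary geometry of tropical hypersurfaces -/

namespace TropPoly

theorem term_add_smul (f : TropPoly σ) (u : σ →₀ ℕ) (w d : σ → ℝ) (t : ℝ) :
    f.term u (w + t • d) = f.term u w + t * ∑ s, (u s : ℝ) * d s := by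
  simp only [term, Pi.add_apply, Pi.smul_apply, smul_eq_mul, mul_add, Finset.sum_add_distrib,
    Finset.mul_sum, add_assoc]
  congr 2
  exact Finset.sum_congr rfl fun s _ => by ring

theorem term_zero (f : TropPoly σ) (u : σ →₀ ℕ) : f.term u 0 = f.coeff u := by simp [term]

theorem continuous_term (f : TropPoly σ) (u : σ →₀ ℕ) : Continuous (f.term u) := by
  unfold term
  fun_prop

theorem maxTerms_nonempty (f : TropPoly σ) (hf : f.support.Nonempty) (w : σ → ℝ) :
    (f.maxTerms w).Nonempty := by
  obtain ⟨u, hu, h⟩ := f.support.exists_max_image (fun u => f.term u w) hf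
  exact ⟨u, hu, h⟩

theorem mem_zeros_univ {f : TropPoly σ} {w : σ → ℝ} :
    w ∈ f.zeros Set.univ ↔ (f.maxTerms w).Nontrivial := by simp [zeros]

theorem eventually_maxTerms_subset (f : TropPoly σ) (w : σ → ℝ) :
    ∀ᶠ w' in 𝓝 w, f.maxTerms w' ⊆ f.maxTerms w := by
  rcases f.support.eq_empty_or_nonempty with h | h
  · exact Eventually.of_forall fun w' u hu => by simp [maxTerms, h] at hu
  obtain ⟨u₀, hu₀, hmax⟩ := f.maxTerms_nonempty h w
  have : ∀ᶠ w' in 𝓝 w, ∀ u ∈ f.support, f.term u w < f.term u₀ w →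
      f.term u w' < f.term u₀ w' := by
    rw [Finset.eventually_all]
    intro u _
    by_cases hlt : f.term u w < f.term u₀ w
    · filter_upwards [(f.continuous_term u).continuousAt.eventually_lt
        (f.continuous_term u₀).continuousAt hlt] with w' hw' _ using hw'
    · exact Eventually.of_forall fun _ h => absurd h hlt
  filter_upwards [this] with w' hw' u hu
  refine ⟨hu.1, fun u' hu' => (hmax u' hu').trans ?_⟩
  by_contra hlt
  exact absurd (hu.2 u₀ hu₀) (not_le.2 (hw' u hu.1 (not_le.1 hlt)))

theorem isClosed_zeros_univ (f : TropPoly σ) : IsClosed (f.zeros Set.univ) := by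
  rw [← isOpen_compl_iff, isOpen_iff_mem_nhds]
  intro w hw
  filter_upwards [f.eventually_maxTerms_subset w] with w' hw' h
  exact hw (mem_zeros_univ.2 ((mem_zeros_univ.1 h).mono hw'))

theorem isClosed_setOf_mem_maxTerms (f : TropPoly σ) (u : σ →₀ ℕ) :
    IsClosed {w | u ∈ f.maxTerms w} := by
  by_cases hu : u ∈ f.support
  · have : {w | u ∈ f.maxTerms w} = ⋂ u' ∈ f.support, {w | f.term u' w ≤ f.term u w} := by
      ext w
      simp [maxTerms, hu]
    rw [this]
    exact isClosed_biInter fun u' _ => isClosed_le (f.continuous_term u') (f.continuous_term u)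
  · simp [maxTerms, hu]

theorem dense_compl_zeros_univ (f : TropPoly σ) : Dense (f.zeros Set.univ)ᶜ := by
  classical
  intro w
  obtain ⟨e, he⟩ := exists_injOn_linear_form f.support
  let d : σ → ℝ := fun s => e s
  have hd : ∀ u : σ →₀ ℕ, ∑ s, (u s : ℝ) * d s = ((∑ s, u s * e s : ℕ) : ℝ) := by
    intro u
    simp [d]
  -- Along `d` distinct exponents have distinct slopes, so each pair ties at one parameter only.
  let bad : Finset ℝ := (f.support ×ˢ f.support).image fun q =>
    (f.term q.1 w - f.term q.2 w) / (∑ s, (q.2 s : ℝ) * d s - ∑ s, (q.1 s : ℝ) * d s)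
  have hbad : ∀ t, t ∉ bad → w + t • d ∈ (f.zeros Set.univ)ᶜ := by
    intro t ht h
    obtain ⟨u₁, h₁, u₂, h₂, hne⟩ := mem_zeros_univ.1 h
    have h3 := le_antisymm (h₂.2 u₁ h₁.1) (h₁.2 u₂ h₂.1)
    rw [term_add_smul, term_add_smul] at h3
    have h4 : ∑ s, (u₂ s : ℝ) * d s - ∑ s, (u₁ s : ℝ) * d s ≠ 0 := by
      rw [hd, hd, sub_ne_zero]
      exact_mod_cast fun h => hne (he h₂.1 h₁.1 h).symm
    refine ht (Finset.mem_image.2 ⟨(u₁, u₂), Finset.mem_product.2 ⟨h₁.1, h₂.1⟩, ?_⟩)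
    rw [div_eq_iff h4]
    linarith
  have hdense : Dense ((bad : Set ℝ)ᶜ) := bad.finite_toSet.countable.dense_compl ℝ
  have hc : Continuous fun t : ℝ => w + t • d := by fun_prop
  have := map_mem_closure hc (hdense 0) hbad
  simpa using this

/-- Off the hypersurface a term is either the strict maximum or strictly beaten: two disjoint open
conditions that cover `A`. -/
theorem mem_maxTerms_of_isPreconnected {f : TropPoly σ} {A : Set (σ → ℝ)} (hA : IsPreconnected A)
    (hdisj : ∀ w ∈ A, w ∉ f.zeros Set.univ) {w w' : σ → ℝ} (hw : w ∈ A) (hw' : w' ∈ A)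
    {u : σ →₀ ℕ} (hu : u ∈ f.maxTerms w) : u ∈ f.maxTerms w' := by
  let U : Set (σ → ℝ) := ⋂ u' ∈ f.support.filter (· ≠ u), {w | f.term u' w < f.term u w}
  let V : Set (σ → ℝ) := ⋃ u' ∈ f.support, {w | f.term u w < f.term u' w}
  have hU : IsOpen U := isOpen_biInter_finset fun u' _ =>
    isOpen_lt (f.continuous_term u') (f.continuous_term u)
  have hV : IsOpen V := isOpen_biUnion fun u' _ =>
    isOpen_lt (f.continuous_term u) (f.continuous_term u')
  have hUV : Disjoint U V := by
    rw [Set.disjoint_left]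
    intro x hxU hxV
    obtain ⟨u', hu', hlt⟩ := Set.mem_iUnion₂.1 hxV
    have hlt : f.term u x < f.term u' x := hlt
    have hne : u' ≠ u := by
      rintro rfl
      exact lt_irrefl _ hlt
    exact lt_asymm hlt (Set.mem_iInter₂.1 hxU u' (Finset.mem_filter.2 ⟨hu', hne⟩))
  have hmemU : ∀ x ∈ A, u ∈ f.maxTerms x → x ∈ U := by
    intro x hx hux
    refine Set.mem_iInter₂.2 fun u' hu' => ?_
    obtain ⟨hu', hne⟩ := Finset.mem_filter.1 hu'
    refine lt_of_le_of_ne (hux.2 u' hu') fun heq => ?_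
    refine hdisj x hx (mem_zeros_univ.2 ⟨u', ⟨hu', fun u'' h => ?_⟩, u, hux, hne⟩)
    rw [heq]
    exact hux.2 u'' h
  have hcover : A ⊆ U ∪ V := by
    intro x hx
    by_cases hux : u ∈ f.maxTerms x
    · exact Or.inl (hmemU x hx hux)
    · right
      by_contra hV
      refine hux ⟨hu.1, fun u' hu' => not_lt.1 fun h => hV ?_⟩
      exact Set.mem_iUnion₂.2 ⟨u', hu', h⟩
  have hsub := hA.subset_left_of_subset_union hU hV hUV hcover ⟨w, hw, hmemU w hw hu⟩
  refine ⟨hu.1, fun u' hu' => ?_⟩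
  by_cases hne : u' = u
  · rw [hne]
  · exact (Set.mem_iInter₂.1 (hsub hw') u' (Finset.mem_filter.2 ⟨hu', hne⟩)).le

/-! ### Density of the points over a divisible dense group -/

/-- On a line along which a maximal term stops being maximal, it meets another one on the way. -/
theorem exists_tie_on_line {f : TropPoly σ} {w d : σ → ℝ} {δ : ℝ} (hδ : 0 < δ) {u : σ →₀ ℕ}
    (hu : u ∈ f.maxTerms (w + (-δ) • d)) (hu' : u ∉ f.maxTerms (w + δ • d)) :
    ∃ t, |t| ≤ δ ∧ ∃ u', u ∈ f.maxTerms (w + t • d) ∧ u' ∈ f.maxTerms (w + t • d) ∧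
      ∑ s, (u s : ℝ) * d s ≠ ∑ s, (u' s : ℝ) * d s := by
  classical
  set L : (σ →₀ ℕ) → ℝ := fun u => ∑ s, (u s : ℝ) * d s with hL
  have ht : ∀ (u : σ →₀ ℕ) t, f.term u (w + t • d) = f.term u w + t * L u := fun u t =>
    f.term_add_smul u w d t
  let B := f.support.filter fun u' => f.term u (w + δ • d) < f.term u' (w + δ • d)
  have hB : B.Nonempty := by
    by_contra h
    rw [Finset.not_nonempty_iff_eq_empty, Finset.filter_eq_empty_iff] at h
    exact hu' ⟨hu.1, fun u' h' => not_lt.1 (h h')⟩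
  have hleft : ∀ u' ∈ f.support, f.term u' w + -δ * L u' ≤ f.term u w + -δ * L u := by
    intro u' h'
    rw [← ht, ← ht]
    exact hu.2 u' h'
  have hright : ∀ u' ∈ B, f.term u w + δ * L u < f.term u' w + δ * L u' := by
    intro u' h'
    rw [← ht, ← ht]
    exact (Finset.mem_filter.1 h').2
  have hslope : ∀ u' ∈ B, 0 < L u' - L u := by
    intro u' h'
    have h1 := hleft u' (Finset.mem_filter.1 h').1
    have h2 := hright u' h'
    by_contra h
    nlinarith
  -- `τ u'` is the parameter at which `u'` overtakes `u`; the tie sought is the first overtaking.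
  let τ : (σ →₀ ℕ) → ℝ := fun u' => (f.term u w - f.term u' w) / (L u' - L u)
  obtain ⟨u₁, hu₁, hmin⟩ := B.exists_min_image τ hB
  have hτ : τ u₁ * (L u₁ - L u) = f.term u w - f.term u₁ w :=
    div_mul_cancel₀ _ (hslope u₁ hu₁).ne'
  have hu₁S := (Finset.mem_filter.1 hu₁).1
  have hτ1 : -δ ≤ τ u₁ := by
    rw [le_div_iff₀ (hslope u₁ hu₁)]
    linarith [hleft u₁ hu₁S]
  have hτ2 : τ u₁ ≤ δ := by
    rw [div_le_iff₀ (hslope u₁ hu₁)]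
    linarith [hright u₁ hu₁]
  have hmax : ∀ u' ∈ f.support, f.term u' (w + τ u₁ • d) ≤ f.term u (w + τ u₁ • d) := by
    intro u' h'
    rw [ht, ht]
    by_cases hB' : u' ∈ B
    · have h1 := hmin u' hB'
      rw [le_div_iff₀ (hslope u' hB')] at h1
      linarith
    · have h1 : f.term u' w + δ * L u' ≤ f.term u w + δ * L u := by
        rw [← ht, ← ht]
        exact not_lt.1 fun h => hB' (Finset.mem_filter.2 ⟨h', h⟩)
      have h2 := hleft u' h'
      nlinarith [mul_nonneg (sub_nonneg.2 hτ2) (sub_nonneg.2 h2),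
        mul_nonneg (by linarith : 0 ≤ τ u₁ + δ) (sub_nonneg.2 h1)]
  refine ⟨τ u₁, abs_le.2 ⟨hτ1, hτ2⟩, u₁, ⟨hu.1, hmax⟩, ⟨hu₁S, fun u' h' => ?_⟩, ?_⟩
  · refine (hmax u' h').trans (le_of_eq ?_)
    rw [ht, ht]
    linarith
  · exact (sub_pos.1 (hslope u₁ hu₁)).ne

/-- Through a Γ-point near `w` runs a short segment in the integral direction `u₁ - u₂`, whose ends
have no common maximal term. A tie on it occurs at a difference of elements of Γ divided by an
integer, hence at a Γ-point. -/
theorem zeros_univ_subset_closure (f : TropPoly σ) (Γ : AddSubgroup ℝ)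
    (hdiv : ∀ γ ∈ Γ, ∀ n : ℤ, γ / n ∈ Γ) (hdense : Dense (Γ : Set ℝ))
    (hcoeff : ∀ u ∈ f.support, f.coeff u ∈ Γ) :
    f.zeros Set.univ ⊆ closure (f.zeros Γ) := by
  intro w hw
  obtain ⟨u₁, h₁, u₂, h₂, hne⟩ := mem_zeros_univ.1 hw
  let d : σ → ℝ := fun s => (u₁ s : ℝ) - u₂ s
  have hd : 0 < ∑ s, (u₁ s : ℝ) * d s - ∑ s, (u₂ s : ℝ) * d s := by
    rw [← Finset.sum_sub_distrib]
    obtain ⟨s, hs⟩ := DFunLike.ne_iff.1 hne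
    refine Finset.sum_pos' (fun s _ => ?_) ⟨s, Finset.mem_univ s, ?_⟩
    · rw [← sub_mul]
      exact mul_self_nonneg _
    · rw [← sub_mul]
      exact mul_self_pos.2 (sub_ne_zero.2 (by exact_mod_cast hs))
  rw [Metric.mem_closure_iff]
  intro ε hε
  obtain ⟨δ, hδ, hδε⟩ : ∃ δ > 0, δ * ‖d‖ < ε / 2 := by
    refine ⟨ε / 2 / (‖d‖ + 1), by positivity, ?_⟩
    rw [div_mul_eq_mul_div, div_lt_iff₀ (by positivity)]
    nlinarith [norm_nonneg d]
  -- This prevents one `u` from being maximal at both ends. At `w` the gap is at least `δ` times the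
  -- slope difference in `hd`, and strictness persists nearby.
  have hev : ∀ᶠ P in 𝓝 w, ∀ u ∈ f.support,
      f.term u (P + (-δ) • d) + f.term u (P + δ • d) <
        f.term u₂ (P + (-δ) • d) + f.term u₁ (P + δ • d) := by
    rw [Finset.eventually_all]
    intro u hu
    have hc : ∀ (u : σ →₀ ℕ) (t : ℝ), Continuous fun P => f.term u (P + t • d) := fun u t =>
      (f.continuous_term u).comp (by fun_prop)
    refine ((hc _ _).add (hc _ _)).continuousAt.eventually_lt
      ((hc _ _).add (hc _ _)).continuousAt ?_
    simp only [Pi.add_apply, term_add_smul]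
    nlinarith [h₁.2 u hu, h₂.2 u hu]
  have hΓdense : Dense (Set.univ.pi fun _ : σ => (Γ : Set ℝ)) :=
    dense_pi _ fun _ _ => hdense
  obtain ⟨P, hPΓ, hP, hPε⟩ := hΓdense.inter_nhds_nonempty
    (hev.and (Metric.ball_mem_nhds w (half_pos hε)))
  have hPΓ : ∀ s, P s ∈ Γ := fun s => hPΓ s (Set.mem_univ s)
  obtain ⟨u, hu⟩ := f.maxTerms_nonempty ⟨u₁, h₁.1⟩ (P + (-δ) • d)
  have hu' : u ∉ f.maxTerms (P + δ • d) := fun h => by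
    linarith [hP u hu.1, hu.2 u₂ h₂.1, h.2 u₁ h₁.1]
  obtain ⟨t, htδ, u', h, h', hL⟩ := exists_tie_on_line hδ hu hu'
  have hterm : ∀ u ∈ f.support, f.term u P ∈ Γ := fun u hu =>
    Γ.add_mem (hcoeff u hu) (Γ.sum_mem fun s _ => by
      rw [← nsmul_eq_mul]
      exact Γ.nsmul_mem (hPΓ s) _)
  have htΓ : t ∈ Γ := by
    have heq := le_antisymm (h'.2 u h.1) (h.2 u' h'.1)
    rw [term_add_smul, term_add_smul] at heq
    have hn : ∑ s, (u' s : ℝ) * d s - ∑ s, (u s : ℝ) * d s =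
        ((∑ s, (u' s : ℤ) * ((u₁ s : ℤ) - u₂ s) - ∑ s, (u s : ℤ) * ((u₁ s : ℤ) - u₂ s) : ℤ) : ℝ) := by
      push_cast
      rfl
    have : t = (f.term u P - f.term u' P) /
        ((∑ s, (u' s : ℤ) * ((u₁ s : ℤ) - u₂ s) - ∑ s, (u s : ℤ) * ((u₁ s : ℤ) - u₂ s) : ℤ) : ℝ) := by
      rw [← hn, eq_div_iff (sub_ne_zero.2 hL.symm)]
      linarith
    rw [this]
    exact hdiv _ (Γ.sub_mem (hterm u h.1) (hterm u' h'.1)) _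
  refine ⟨P + t • d, ⟨fun s => ?_, u, h, u', h', fun h => hL (by rw [h])⟩, ?_⟩
  · refine Γ.add_mem (hPΓ s) ?_
    have : (t • d) s = ((u₁ s : ℤ) - u₂ s : ℤ) • t := by
      simp [d, mul_comm]
    rw [this]
    exact Γ.zsmul_mem htΓ _
  · rw [dist_comm]
    calc dist (P + t • d) w ≤ dist (P + t • d) P + dist P w := dist_triangle _ _ _
      _ < ε / 2 + ε / 2 := by
        refine add_lt_add ?_ hPε
        rw [dist_eq_norm, add_sub_cancel_left, norm_smul, Real.norm_eq_abs]
        exact (mul_le_mul_of_nonneg_right htδ (norm_nonneg d)).trans_lt hδε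
      _ = ε := add_halves ε

end TropPoly

/-! ### Faces of convex hulls -/

theorem face_convexHull (B : Set (σ → ℝ)) (w : σ → ℝ) :
    face (convexHull ℝ B) w =
      convexHull ℝ {x | x ∈ B ∧ ∀ y ∈ B, ∑ s, w s * y s ≤ ∑ s, w s * x s} := by
  let ℓ : (σ → ℝ) →ₗ[ℝ] ℝ := ∑ s, w s • LinearMap.proj s
  have hℓ : ∀ x : σ → ℝ, ∑ s, w s * x s = ℓ x := fun x => by simp [ℓ]
  simp only [face, hℓ]
  set A := {x | x ∈ B ∧ ∀ y ∈ B, ℓ y ≤ ℓ x} with hA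
  have hle : ∀ c, (∀ y ∈ B, ℓ y ≤ c) → ∀ y ∈ convexHull ℝ B, ℓ y ≤ c := fun c hc y hy =>
    convexHull_min (t := {y | ℓ y ≤ c}) hc (convex_halfSpace_le ℓ.isLinear c) hy
  ext x
  constructor
  · rintro ⟨hx, hmax⟩
    have hmaxA : ∀ y ∈ convexHull ℝ A, ℓ y ≤ ℓ x := fun y hy =>
      hmax y (convexHull_mono (fun z hz => hz.1) hy)
    -- This convex set contains `B`, hence `x`, and `x` is not in the open half-space.
    have hconv : Convex ℝ ({y | ℓ y < ℓ x} ∪ convexHull ℝ A) := by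
      rw [convex_iff_forall_pos]
      have hmix : ∀ y z : σ → ℝ, ℓ y < ℓ x → ℓ z ≤ ℓ x → ∀ a b : ℝ, 0 < a → 0 < b → a + b = 1 →
          ℓ (a • y + b • z) < ℓ x := by
        intro y z hy hz a b ha hb hab
        rw [map_add, map_smul, map_smul, smul_eq_mul, smul_eq_mul]
        calc a * ℓ y + b * ℓ z < a * ℓ x + b * ℓ x :=
              add_lt_add_of_lt_of_le (mul_lt_mul_of_pos_left hy ha)
                (mul_le_mul_of_nonneg_left hz hb.le)
          _ = ℓ x := by rw [← add_mul, hab, one_mul]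
      rintro y (hy | hy) z (hz | hz) a b ha hb hab
      · exact Or.inl (hmix y z hy (le_of_lt hz) a b ha hb hab)
      · exact Or.inl (hmix y z hy (hmaxA z hz) a b ha hb hab)
      · left
        rw [add_comm]
        exact hmix z y hz (hmaxA y hy) b a hb ha (by rwa [add_comm])
      · exact Or.inr (convex_convexHull ℝ A hy hz ha.le hb.le hab)
    have hB : B ⊆ {y | ℓ y < ℓ x} ∪ convexHull ℝ A := by
      intro b hb
      rcases (hmax b (subset_convexHull ℝ B hb)).lt_or_eq with h | h
      · exact Or.inl h
      · refine Or.inr (subset_convexHull ℝ A ⟨hb, fun y hy => ?_⟩)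
        rw [h]
        exact hmax y (subset_convexHull ℝ B hy)
    exact (convexHull_min hB hconv hx).resolve_left (lt_irrefl (ℓ x))
  · intro hx
    refine ⟨convexHull_mono (fun z hz => hz.1) hx, fun y hy => ?_⟩
    exact convexHull_min (t := {x | ℓ y ≤ ℓ x}) (fun z hz => hle _ hz.2 y hy)
      (convex_halfSpace_ge ℓ.isLinear _) hx

theorem toReal_injective {τ : Type*} : Function.Injective (toReal : (τ →₀ ℕ) → τ → ℝ) := by
  intro u u' h
  ext s
  have hs : (u s : ℝ) = u' s := congrFun h s
  exact_mod_cast hs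

/-! ### Tropical polynomials whose hypersurface is a cone -/

namespace TropPoly

theorem term_eq (f : TropPoly σ) (u : σ →₀ ℕ) (w : σ → ℝ) :
    f.term u w = f.coeff u + ∑ s, w s * toReal u s := by
  simp only [term, toReal, mul_comm]

/-- Off the hypersurface the dominant term is constant along the open ray through `w`. Letting the
parameter tend to zero gives a maximal coefficient, large parameters a maximal linear form. Density
of the complement extends this to all `w`, since `C` is a finite union of closed sets. -/
theorem exists_mem_maxTerms_zero {f : TropPoly σ} (hf : f.support.Nonempty)
    (hcone : ∀ t : ℝ, 0 < t → ∀ w ∈ f.zeros Set.univ, t • w ∈ f.zeros Set.univ)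
    (w : σ → ℝ) :
    ∃ u ∈ f.maxTerms 0, ∀ u' ∈ f.support,
      ∑ s, w s * toReal u' s ≤ ∑ s, w s * toReal u s := by
  classical
  let C : Set (σ → ℝ) := ⋃ u ∈ f.support.filter (· ∈ f.maxTerms 0),
    {w | ∀ u' ∈ f.support, ∑ s, w s * toReal u' s ≤ ∑ s, w s * toReal u s}
  have hC : IsClosed C := by
    refine isClosed_biUnion_finset fun u _ => ?_
    simp only [Set.ofPred_forall]
    exact isClosed_biInter fun u' _ => isClosed_le (by fun_prop) (by fun_prop)
  have hsub : (f.zeros Set.univ)ᶜ ⊆ C := by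
    intro w hw
    obtain ⟨u, hu⟩ := f.maxTerms_nonempty hf w
    have hA : IsPreconnected ((fun t : ℝ => t • w) '' Set.Ioi 0) :=
      isPreconnected_Ioi.image _ (by fun_prop)
    have hray : ∀ t : ℝ, 0 < t → u ∈ f.maxTerms (t • w) := by
      intro t ht
      refine mem_maxTerms_of_isPreconnected hA ?_ ⟨1, by simp, one_smul ℝ w⟩ ⟨t, ht, rfl⟩ hu
      rintro _ ⟨r, hr, rfl⟩ h
      apply hw
      have := hcone r⁻¹ (inv_pos.2 hr) _ h
      rwa [smul_smul, inv_mul_cancel₀ (ne_of_gt hr), one_smul] at this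
    have hterm : ∀ u (t : ℝ), f.term u (t • w) = f.coeff u + t * ∑ s, w s * toReal u s := by
      intro u t
      rw [term_eq, Finset.mul_sum]
      simp [mul_assoc]
    have hu0 : u ∈ f.maxTerms 0 := by
      have hcl : IsClosed {t : ℝ | u ∈ f.maxTerms (t • w)} :=
        (f.isClosed_setOf_mem_maxTerms u).preimage (f := fun t : ℝ => t • w) (by fun_prop)
      have h0 : (0 : ℝ) ∈ closure (Set.Ioi 0) := by simp
      have := hcl.closure_subset_iff.2 (fun t ht => hray t ht) h0
      simpa using this
    refine Set.mem_iUnion₂.2 ⟨u, Finset.mem_filter.2 ⟨hu.1, hu0⟩, fun u' hu' => ?_⟩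
    by_contra hlt
    push Not at hlt
    have h1 : ∀ t : ℝ, 0 < t → f.coeff u' - f.coeff u + t *
        (∑ s, w s * toReal u' s - ∑ s, w s * toReal u s) ≤ 0 := by
      intro t ht
      have := (hray t ht).2 u' hu'
      rw [hterm, hterm] at this
      linarith
    have hpos := sub_pos.2 hlt
    set b := ∑ s, w s * toReal u' s - ∑ s, w s * toReal u s
    have h2 := h1 ((|f.coeff u' - f.coeff u| + 1) / b) (by positivity)
    rw [div_mul_cancel₀ _ hpos.ne'] at h2
    linarith [neg_abs_le (f.coeff u' - f.coeff u)]
  have hw : w ∈ C := hC.closure_subset_iff.2 hsub (f.dense_compl_zeros_univ w)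
  obtain ⟨u, hu, h⟩ := Set.mem_iUnion₂.1 hw
  exact ⟨u, (Finset.mem_filter.1 hu).2, h⟩

/-- Some exponent maximizes the coefficient and the linear form at once, so the maximum of the sum
is the sum of the maxima. -/
theorem mem_maxTerms_iff_of_cone {f : TropPoly σ} (hf : f.support.Nonempty)
    (hcone : ∀ t : ℝ, 0 < t → ∀ w ∈ f.zeros Set.univ, t • w ∈ f.zeros Set.univ)
    {u : σ →₀ ℕ} {w : σ → ℝ} :
    u ∈ f.maxTerms w ↔ u ∈ f.maxTerms 0 ∧
      ∀ u' ∈ f.support, ∑ s, w s * toReal u' s ≤ ∑ s, w s * toReal u s := by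
  have h0 : ∀ {u}, u ∈ f.maxTerms 0 → ∀ u' ∈ f.support, f.coeff u' ≤ f.coeff u := by
    intro u hu u' hu'
    simpa only [term_zero] using hu.2 u' hu'
  constructor
  · intro hu
    obtain ⟨u₀, hu₀, hmax⟩ := exists_mem_maxTerms_zero hf hcone w
    have h1 := hu.2 u₀ hu₀.1
    rw [term_eq, term_eq] at h1
    have h2 := hmax u hu.1
    have h3 := h0 hu₀ u hu.1
    refine ⟨⟨hu.1, fun u' hu' => ?_⟩, fun u' hu' => ?_⟩
    · rw [term_zero, term_zero]
      linarith [h0 hu₀ u' hu']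
    · linarith [hmax u' hu']
  · rintro ⟨hu, hmax⟩
    refine ⟨hu.1, fun u' hu' => ?_⟩
    rw [term_eq, term_eq]
    exact add_le_add (h0 hu u' hu') (hmax u' hu')

theorem convexHull_support_eq {f : TropPoly σ} (hf : f.support.Nonempty)
    (hcone : ∀ t : ℝ, 0 < t → ∀ w ∈ f.zeros Set.univ, t • w ∈ f.zeros Set.univ) :
    convexHull ℝ (toReal '' (f.support : Set (σ →₀ ℕ))) =
      convexHull ℝ (toReal '' f.maxTerms 0) := by
  classical
  refine Set.Subset.antisymm (convexHull_min ?_ (convex_convexHull ℝ _))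
    (convexHull_mono (Set.image_mono fun u hu => hu.1))
  rintro _ ⟨u, hu, rfl⟩
  by_contra hnot
  have hfin : (toReal '' f.maxTerms 0).Finite :=
    (f.support.finite_toSet.subset fun u hu => hu.1).image _
  obtain ⟨g, c, hgu, hg⟩ := geometric_hahn_banach_point_closed (convex_convexHull ℝ _)
    (hfin.isCompact_convexHull ℝ).isClosed hnot
  have hsum : ∀ x : σ → ℝ, g x = ∑ s, g (Pi.single s 1) * x s := fun x => by
    have := LinearMap.pi_apply_eq_sum_univ (g : (σ → ℝ) →ₗ[ℝ] ℝ) x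
    simp only [ContinuousLinearMap.coe_coe, smul_eq_mul] at this
    rw [this]
    refine Finset.sum_congr rfl fun s _ => ?_
    rw [mul_comm]
    congr 2
    ext i
    simp [Pi.single_apply, eq_comm]
  -- The separating functional is smaller at `u` than on the hull, hence the sign.
  obtain ⟨u₀, hu₀, hmax⟩ := exists_mem_maxTerms_zero hf hcone (fun s => -g (Pi.single s 1))
  have h1 := hmax u hu
  simp only [neg_mul, Finset.sum_neg_distrib, ← hsum] at h1
  have h2 := hg _ (subset_convexHull ℝ _ ⟨u₀, hu₀, rfl⟩)
  linarith

theorem dualCell_eq_face {f : TropPoly σ} (hf : f.support.Nonempty)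
    (hcone : ∀ t : ℝ, 0 < t → ∀ w ∈ f.zeros Set.univ, t • w ∈ f.zeros Set.univ)
    (w : σ → ℝ) :
    f.dualCell w = face (convexHull ℝ (toReal '' (f.support : Set (σ →₀ ℕ)))) w := by
  rw [convexHull_support_eq hf hcone, face_convexHull, dualCell]
  congr 1
  ext x
  constructor
  · rintro ⟨u, hu, rfl⟩
    have h := (mem_maxTerms_iff_of_cone hf hcone).1 hu
    refine ⟨⟨u, h.1, rfl⟩, ?_⟩
    rintro _ ⟨u', hu', rfl⟩
    exact h.2 u' hu'.1
  · rintro ⟨⟨u, hu, rfl⟩, hmax⟩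
    refine ⟨u, (mem_maxTerms_iff_of_cone hf hcone).2 ⟨hu, fun u' hu' => ?_⟩, rfl⟩
    obtain ⟨u₀, hu₀, hmax₀⟩ := exists_mem_maxTerms_zero hf hcone w
    exact (hmax₀ u' hu').trans (hmax _ ⟨u₀, hu₀, rfl⟩)

/-- A dual cell may contain exponents with smaller coefficients, which do not attain the maximum.
Those in `maxTerms w₀` have maximal coefficient, so membership in the cell of `w` makes them maximal
at `w`. -/
theorem dualCell_subset_iff {f : TropPoly σ} (hf : f.support.Nonempty)
    (hcone : ∀ t : ℝ, 0 < t → ∀ w ∈ f.zeros Set.univ, t • w ∈ f.zeros Set.univ)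
    {w₀ w : σ → ℝ} :
    f.dualCell w₀ ⊆ f.dualCell w ↔ f.maxTerms w₀ ⊆ f.maxTerms w := by
  refine ⟨fun h u hu => ?_, fun h => convexHull_mono (Set.image_mono h)⟩
  have h1 : toReal u ∈ f.dualCell w := h (subset_convexHull ℝ _ ⟨u, hu, rfl⟩)
  rw [dualCell_eq_face hf hcone] at h1
  refine (mem_maxTerms_iff_of_cone hf hcone).2
    ⟨((mem_maxTerms_iff_of_cone hf hcone).1 hu).1, fun u' hu' => ?_⟩
  exact h1.2 _ (subset_convexHull ℝ _ ⟨u', hu', rfl⟩)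

/-! ### Recovering the complex from the hypersurface as a set -/

/-- The closed region where `u` is maximal consists of the points visible from `w₁` inside it. The
end `w` of the segment is left out because it may lie on the hypersurface. -/
theorem mem_maxTerms_iff_segment {f : TropPoly σ} {w w₁ : σ → ℝ} (hw₁ : w₁ ∉ f.zeros Set.univ) {u : σ →₀ ℕ}
    (hu : u ∈ f.maxTerms w₁) :
    u ∈ f.maxTerms w ↔ ∀ t ∈ Set.Ioc (0 : ℝ) 1, w + t • (w₁ - w) ∉ f.zeros Set.univ := by
  constructor
  · intro huw t ht hz
    have hlt : ∀ u' ∈ f.support, u' ≠ u → f.term u' w₁ < f.term u w₁ := by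
      intro u' hu' hne
      refine lt_of_le_of_ne (hu.2 u' hu') fun heq => hw₁ (mem_zeros_univ.2
        ⟨u', ⟨hu', fun u'' h => ?_⟩, u, hu, hne⟩)
      rw [heq]
      exact hu.2 u'' h
    have hterm : ∀ u', f.term u' (w + t • (w₁ - w)) = (1 - t) * f.term u' w + t * f.term u' w₁ := by
      intro u'
      rw [term_add_smul]
      have : f.term u' w₁ = f.term u' w + 1 * ∑ s, (u' s : ℝ) * (w₁ - w) s := by
        rw [← term_add_smul, one_smul, add_sub_cancel]
      rw [this]
      ring
    have huniq : ∀ u' ∈ f.maxTerms (w + t • (w₁ - w)), u' = u := by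
      intro u' hu'
      by_contra hne
      have h1 := hu'.2 u hu.1
      rw [hterm, hterm] at h1
      have h2 := mul_lt_mul_of_pos_left (hlt u' hu'.1 hne) ht.1
      have h3 := mul_le_mul_of_nonneg_left (huw.2 u' hu'.1) (sub_nonneg.2 ht.2)
      linarith
    obtain ⟨a, ha, b, hb, hab⟩ := mem_zeros_univ.1 hz
    exact hab ((huniq a ha).trans (huniq b hb).symm)
  · intro h
    have hA : IsPreconnected ((fun t : ℝ => w + t • (w₁ - w)) '' Set.Ioc 0 1) :=
      isPreconnected_Ioc.image _ (by fun_prop)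
    have hseg : ∀ t ∈ Set.Ioc (0 : ℝ) 1, u ∈ f.maxTerms (w + t • (w₁ - w)) := by
      intro t ht
      refine mem_maxTerms_of_isPreconnected hA ?_ ⟨1, by simp, by simp⟩ ⟨t, ht, rfl⟩ hu
      rintro _ ⟨r, hr, rfl⟩
      exact h r hr
    have hcl : IsClosed {t : ℝ | u ∈ f.maxTerms (w + t • (w₁ - w))} :=
      (f.isClosed_setOf_mem_maxTerms u).preimage (f := fun t : ℝ => w + t • (w₁ - w))
        (by fun_prop)
    have h0 : (0 : ℝ) ∈ closure (Set.Ioc (0 : ℝ) 1) := by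
      rw [closure_Ioc zero_ne_one]
      simp
    have := hcl.closure_subset_iff.2 hseg h0
    simpa using this

/-- Inclusion of dual cells in terms of the tropical hypersurface alone. -/
theorem dualCell_subset_iff_segments {f : TropPoly σ} (hf : f.support.Nonempty)
    (hcone : ∀ t : ℝ, 0 < t → ∀ w ∈ f.zeros Set.univ, t • w ∈ f.zeros Set.univ)
    {w₀ w : σ → ℝ} :
    f.dualCell w₀ ⊆ f.dualCell w ↔ ∀ w₁ ∉ f.zeros Set.univ,
      (∀ t ∈ Set.Ioc (0 : ℝ) 1, w₀ + t • (w₁ - w₀) ∉ f.zeros Set.univ) →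
        ∀ t ∈ Set.Ioc (0 : ℝ) 1, w + t • (w₁ - w) ∉ f.zeros Set.univ := by
  rw [dualCell_subset_iff hf hcone]
  constructor
  · intro h w₁ hw₁ h₀
    obtain ⟨u, hu⟩ := f.maxTerms_nonempty hf w₁
    rw [← mem_maxTerms_iff_segment hw₁ hu] at h₀ ⊢
    exact h h₀
  · intro h u hu
    refine (mem_maxTerms_iff_of_cone hf hcone).2
      ⟨((mem_maxTerms_iff_of_cone hf hcone).1 hu).1, fun u' hu' => ?_⟩
    -- A small step from `w₀` along `-w` selects the maximal terms at `w₀` with the least value of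
    -- `⟨w, ·⟩`. A generic point nearby has such a term `u₁`; visibility makes `u₁` maximal at `w`,
    -- so all of `maxTerms w₀` reaches the maximum of `⟨w, ·⟩`.
    have hev : ∀ᶠ t : ℝ in 𝓝[>] 0, f.maxTerms (w₀ + t • -w) ⊆ f.maxTerms w₀ := by
      have hc : Tendsto (fun t : ℝ => w₀ + t • -w) (𝓝[>] 0) (𝓝 w₀) := by
        have : Continuous fun t : ℝ => w₀ + t • -w := by fun_prop
        simpa using (this.tendsto 0).mono_left nhdsWithin_le_nhds
      exact hc.eventually (f.eventually_maxTerms_subset w₀)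
    obtain ⟨t, ht, htpos⟩ := (hev.and self_mem_nhdsWithin).exists
    obtain ⟨w₁, hw₁, hsub⟩ := f.dense_compl_zeros_univ.inter_nhds_nonempty
      (f.eventually_maxTerms_subset (w₀ + t • -w))
    obtain ⟨u₁, hu₁⟩ := f.maxTerms_nonempty hf w₁
    have h1 := hsub hu₁
    have h2 := h w₁ hw₁ ((mem_maxTerms_iff_segment hw₁ hu₁).1 (ht h1))
    have h3 := (mem_maxTerms_iff_segment hw₁ hu₁).2 h2
    have h4 := ((mem_maxTerms_iff_of_cone hf hcone).1 h3).2 u' hu'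
    have h5 := h1.2 u hu.1
    rw [term_add_smul, term_add_smul] at h5
    have h6 := hu.2 u₁ hu₁.1
    have h7 : ∀ u : σ →₀ ℕ, ∑ s, (u s : ℝ) * (-w) s = -∑ s, w s * toReal u s := fun u => by
      simp [toReal, mul_comm]
    rw [h7, h7] at h5
    have h8 : t * ∑ s, w s * toReal u₁ s ≤ t * ∑ s, w s * toReal u s := by linarith
    exact h4.trans (le_of_mul_le_mul_left h8 htpos)

theorem cells_eq_dualFan {f : TropPoly σ} (hf : f.support.Nonempty)
    (hcone : ∀ t : ℝ, 0 < t → ∀ w ∈ f.zeros Set.univ, t • w ∈ f.zeros Set.univ) :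
    f.cells = dualFan (convexHull ℝ (toReal '' (f.support : Set (σ →₀ ℕ)))) := by
  have hnt : ∀ w, w ∈ f.zeros Set.univ ↔ (f.dualCell w).Nontrivial := by
    intro w
    rw [mem_zeros_univ]
    constructor
    · exact fun h => (h.image toReal_injective).mono (subset_convexHull ℝ _)
    · intro h
      by_contra hs
      rw [Set.not_nontrivial_iff] at hs
      rcases (hs.image toReal).eq_empty_or_singleton with h' | ⟨x, h'⟩ <;>
        simp [dualCell, h'] at h
  simp only [cells, dualFan, hnt, dualCell_eq_face hf hcone]

theorem sUnion_dualFan_eq {f : TropPoly σ} (hf : f.support.Nonempty)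
    (hcone : ∀ t : ℝ, 0 < t → ∀ w ∈ f.zeros Set.univ, t • w ∈ f.zeros Set.univ) :
    ⋃₀ dualFan (convexHull ℝ (toReal '' (f.support : Set (σ →₀ ℕ)))) = f.zeros Set.univ := by
  rw [← cells_eq_dualFan hf hcone]
  ext w
  constructor
  · rintro ⟨_, ⟨w₀, hw₀, rfl⟩, hw⟩
    exact mem_zeros_univ.2 ((mem_zeros_univ.1 hw₀).mono ((dualCell_subset_iff hf hcone).1 hw))
  · exact fun hw => ⟨_, ⟨w, hw, rfl⟩, Set.Subset.rfl⟩

/-- The complex carried by a conical tropical hypersurface depends only on the hypersurface. -/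
theorem cells_eq_of_zeros_eq {f g : TropPoly σ} (hf : f.support.Nonempty) (hg : g.support.Nonempty)
    (hcone : ∀ t : ℝ, 0 < t → ∀ w ∈ f.zeros Set.univ, t • w ∈ f.zeros Set.univ)
    (h : f.zeros Set.univ = g.zeros Set.univ) : f.cells = g.cells := by
  have hcone' := hcone
  rw [h] at hcone'
  simp only [cells, dualCell_subset_iff_segments hf hcone, dualCell_subset_iff_segments hg hcone',
    h]

end TropPoly

end TropRes

namespace TropRes

open Filter Topology

/-! ### Common tropical roots -/

/-- `t` is a tropical root of the univariate tropical polynomial `max_i (a i + i t)`. -/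
def IsTropRoot {I : Finset ℕ} (a : I → ℝ) (t : ℝ) : Prop :=
  ∃ i₁ i₂ : I, i₁ ≠ i₂ ∧
    ∀ i : I, a i + (i : ℕ) * t ≤ a i₁ + (i₁ : ℕ) * t ∧ a i + (i : ℕ) * t ≤ a i₂ + (i₂ : ℕ) * t

/-- The coefficient vectors of the pairs of univariate tropical polynomials of supports `I`, `J`
with a common tropical root. -/
def commonRootLocus (I J : Finset ℕ) : Set (I ⊕ J → ℝ) :=
  {w | ∃ t, IsTropRoot (fun i => w (Sum.inl i)) t ∧ IsTropRoot (fun j => w (Sum.inr j)) t}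

theorem IsTropRoot.eq_div {I : Finset ℕ} {a : I → ℝ} {t : ℝ} {i₁ i₂ : I} (hne : i₁ ≠ i₂)
    (h : a i₂ + (i₂ : ℕ) * t = a i₁ + (i₁ : ℕ) * t) :
    t = (a i₁ - a i₂) / (((i₂ : ℕ) : ℤ) - ((i₁ : ℕ) : ℤ) : ℤ) := by
  have hd : ((((i₂ : ℕ) : ℤ) - ((i₁ : ℕ) : ℤ) : ℤ) : ℝ) ≠ 0 := by
    rw [Int.cast_ne_zero, sub_ne_zero]
    exact fun h => hne (Subtype.ext (by exact_mod_cast h.symm))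
  rw [eq_div_iff hd]
  push_cast
  linarith

theorem IsTropRoot.mem {I : Finset ℕ} {a : I → ℝ} {t : ℝ} (ht : IsTropRoot a t)
    {Γ : AddSubgroup ℝ} (hdiv : ∀ γ ∈ Γ, ∀ n : ℤ, γ / n ∈ Γ) (ha : ∀ i, a i ∈ Γ) : t ∈ Γ := by
  obtain ⟨i₁, i₂, hne, h⟩ := ht
  rw [IsTropRoot.eq_div hne (le_antisymm (h i₂).1 (h i₁).2)]
  exact hdiv _ (Γ.sub_mem (ha _) (ha _)) _

theorem IsTropRoot.smul {I : Finset ℕ} {a : I → ℝ} {t : ℝ} (ht : IsTropRoot a t) {r : ℝ}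
    (hr : 0 < r) : IsTropRoot (fun i => r * a i) (r * t) := by
  obtain ⟨i₁, i₂, hne, h⟩ := ht
  refine ⟨i₁, i₂, hne, fun i => ?_⟩
  have h1 := mul_le_mul_of_nonneg_left (h i).1 hr.le
  have h2 := mul_le_mul_of_nonneg_left (h i).2 hr.le
  constructor <;> linarith

theorem smul_mem_commonRootLocus {I J : Finset ℕ} {w : I ⊕ J → ℝ} (hw : w ∈ commonRootLocus I J)
    {r : ℝ} (hr : 0 < r) : r • w ∈ commonRootLocus I J := by
  obtain ⟨t, h₁, h₂⟩ := hw
  exact ⟨r * t, h₁.smul hr, h₂.smul hr⟩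

/-- Once the two tying pairs are fixed, the first expresses `t` as a continuous function of `w`.
This leaves a finite union of sets cut out by weak inequalities. -/
theorem isClosed_commonRootLocus (I J : Finset ℕ) : IsClosed (commonRootLocus I J) := by
  classical
  let P : I × I → (I ⊕ J → ℝ) → ℝ → Prop := fun q w t => ∀ i : I,
    w (.inl i) + (i : ℕ) * t ≤ w (.inl q.1) + (q.1 : ℕ) * t ∧
      w (.inl i) + (i : ℕ) * t ≤ w (.inl q.2) + (q.2 : ℕ) * t
  let Q : J × J → (I ⊕ J → ℝ) → ℝ → Prop := fun q w t => ∀ j : J,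
    w (.inr j) + (j : ℕ) * t ≤ w (.inr q.1) + (q.1 : ℕ) * t ∧
      w (.inr j) + (j : ℕ) * t ≤ w (.inr q.2) + (q.2 : ℕ) * t
  let τ : I × I → (I ⊕ J → ℝ) → ℝ := fun q w =>
    (w (.inl q.1) - w (.inl q.2)) / (((q.2 : ℕ) : ℤ) - ((q.1 : ℕ) : ℤ) : ℤ)
  have hτ : ∀ q, Continuous (τ q) := fun q => by fun_prop
  have heq : commonRootLocus I J = ⋃ q : {q : I × I // q.1 ≠ q.2}, ⋃ r : {r : J × J // r.1 ≠ r.2},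
      {w | P q w (τ q w)} ∩ {w | Q r w (τ q w)} := by
    ext w
    simp only [Set.mem_iUnion]
    constructor
    · rintro ⟨t, ⟨i₁, i₂, hi, h⟩, j₁, j₂, hj, h'⟩
      have ht : t = τ (i₁, i₂) w := IsTropRoot.eq_div (a := fun i => w (.inl i)) hi
        (le_antisymm (h i₂).1 (h i₁).2)
      subst ht
      exact ⟨⟨(i₁, i₂), hi⟩, ⟨(j₁, j₂), hj⟩, h, h'⟩
    · rintro ⟨q, r, h, h'⟩
      exact ⟨τ q w, ⟨q.1.1, q.1.2, q.2, h⟩, r.1.1, r.1.2, r.2, h'⟩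
  rw [heq]
  refine isClosed_iUnion_of_finite fun q => isClosed_iUnion_of_finite fun r => ?_
  have := hτ q.1
  refine IsClosed.inter ?_ ?_ <;> simp only [P, Q, Set.ofPred_forall, Set.ofPred_and] <;>
    exact isClosed_iInter fun i =>
      (isClosed_le (by fun_prop) (by fun_prop)).inter (isClosed_le (by fun_prop) (by fun_prop))

/-- Points of the locus are parametrized by the root, the two maxima and nonnegative slacks. The
parametrization has integer coefficients, so approximating the parameters in Γ approximates `w` by
Γ-points. -/
theorem commonRootLocus_subset_closure (I J : Finset ℕ) {Γ : AddSubgroup ℝ}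
    (hΓ : Dense (Γ : Set ℝ)) :
    commonRootLocus I J ⊆ closure {w | w ∈ commonRootLocus I J ∧ ∀ s, w s ∈ Γ} := by
  rintro w ⟨t, ⟨i₁, i₂, hi, h⟩, j₁, j₂, hj, h'⟩
  let deg : I ⊕ J → ℕ := Sum.elim (fun i => i) fun j => j
  let Φ : (ℝ × ℝ × ℝ) × (I ⊕ J → ℝ) → I ⊕ J → ℝ := fun p s =>
    Sum.elim (fun _ => p.1.2.1) (fun _ => p.1.2.2) s - deg s * p.1.1 - p.2 s
  have hΦ : Continuous Φ := by
    refine continuous_pi fun s => ?_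
    cases s <;> simp only [Φ, Sum.elim_inl, Sum.elim_inr] <;> fun_prop
  let c₁ := w (.inl i₁) + (i₁ : ℕ) * t
  let c₂ := w (.inr j₁) + (j₁ : ℕ) * t
  let σ₀ : I ⊕ J → ℝ := fun s =>
    Sum.elim (fun _ => c₁) (fun _ => c₂) s - deg s * t - w s
  have hσ₀ : ∀ s, 0 ≤ σ₀ s := by
    rintro (i | j)
    · simp only [σ₀, c₁, deg, Sum.elim_inl]
      linarith [(h i).1]
    · simp only [σ₀, c₂, deg, Sum.elim_inr]
      linarith [(h' j).1]
  have hwΦ : Φ ((t, c₁, c₂), σ₀) = w := by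
    funext s
    simp only [Φ, σ₀]
    ring
  -- Zero slacks are kept exactly zero, which preserves the ties.
  let slack : I ⊕ J → Set ℝ := fun s => {x | x ∈ Γ ∧ 0 ≤ x ∧ (σ₀ s = 0 → x = 0)}
  have hslack : ∀ s, σ₀ s ∈ closure (slack s) := by
    intro s
    rcases (hσ₀ s).eq_or_lt with h0 | h0
    · rw [← h0]
      exact subset_closure ⟨Γ.zero_mem, le_rfl, fun _ => rfl⟩
    · refine closure_mono ?_ (hΓ.open_subset_closure_inter isOpen_Ioi h0)
      rintro x ⟨hx, hxΓ⟩
      exact ⟨hxΓ, le_of_lt hx, fun h => absurd h h0.ne'⟩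
  let D : Set ((ℝ × ℝ × ℝ) × (I ⊕ J → ℝ)) :=
    ((Γ : Set ℝ) ×ˢ (Γ : Set ℝ) ×ˢ (Γ : Set ℝ)) ×ˢ Set.univ.pi slack
  have hD : ((t, c₁, c₂), σ₀) ∈ closure D := by
    simp only [D, closure_prod_eq, closure_pi_set]
    exact ⟨⟨hΓ t, hΓ c₁, hΓ c₂⟩, fun s _ => hslack s⟩
  have key := map_mem_closure hΦ hD (t := {w | w ∈ commonRootLocus I J ∧ ∀ s, w s ∈ Γ}) ?_
  · rwa [hwΦ] at key
  rintro ⟨⟨t', d₁, d₂⟩, ρ⟩ ⟨⟨ht', hd₁, hd₂⟩, hρ⟩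
  have hρ : ∀ s, ρ s ∈ slack s := fun s => hρ s (Set.mem_univ s)
  have hi₁ : ρ (.inl i₁) = 0 := (hρ _).2.2 (by simp [σ₀, c₁, deg])
  have hi₂ : ρ (.inl i₂) = 0 := (hρ _).2.2 (by
    simp only [σ₀, c₁, deg, Sum.elim_inl]
    linarith [(h i₁).2, (h i₂).1])
  have hj₁ : ρ (.inr j₁) = 0 := (hρ _).2.2 (by simp [σ₀, c₂, deg])
  have hj₂ : ρ (.inr j₂) = 0 := (hρ _).2.2 (by
    simp only [σ₀, c₂, deg, Sum.elim_inr]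
    linarith [(h' j₁).2, (h' j₂).1])
  refine ⟨⟨t', ⟨i₁, i₂, hi, fun i => ?_⟩, j₁, j₂, hj, fun j => ?_⟩, fun s => ?_⟩
  · simp only [Φ, deg, Sum.elim_inl, hi₁, hi₂]
    constructor <;> linarith [(hρ (.inl i)).2.1]
  · simp only [Φ, deg, Sum.elim_inr, hj₁, hj₂]
    constructor <;> linarith [(hρ (.inr j)).2.1]
  · refine Γ.sub_mem (Γ.sub_mem ?_ ?_) (hρ s).1
    · cases s
      · exact hd₁
      · exact hd₂
    · rw [← nsmul_eq_mul]
      exact Γ.nsmul_mem ht' _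

/-! ### Lifting of tropical roots -/

section Lifting

variable {K : Type*} [Field K] (v : AddValuation K (WithTop ℝ))

theorem isTropRoot_of_root {I : Finset ℕ} (h0 : 0 ∈ I) {A : I → K} (hA : ∀ i, A i ≠ 0) {x : K}
    (hx : x ≠ 0) (hroot : ∑ i : I, A i * x ^ (i : ℕ) = 0) :
    IsTropRoot (fun i => trop v (A i)) (trop v x) := by
  have hne : ∀ i : I, A i * x ^ (i : ℕ) ≠ 0 := fun i => mul_ne_zero (hA i) (pow_ne_zero _ hx)
  have htrop : ∀ i : I, trop v (A i * x ^ (i : ℕ)) = trop v (A i) + (i : ℕ) * trop v x :=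
    fun i => by rw [trop_mul v (hA i) (pow_ne_zero _ hx), trop_pow v hx]
  obtain ⟨i, -, j, -, hij, -, -, hmax⟩ := exists_ne_max_of_sum_eq_zero v _ _
    ⟨⟨0, h0⟩, Finset.mem_univ _, hne _⟩ hroot
  refine ⟨i, j, hij, fun k => ?_⟩
  have := hmax k (Finset.mem_univ k) (hne k)
  simpa only [htrop] using this

/-- Start from arbitrary lifts, rescale the one at `i₂` by a unit so that all terms except `i₁` add
up to the tied value without cancellation, and solve for the coefficient at `i₁`. -/
theorem exists_lift_of_isTropRoot [IsAlgClosed K] {I : Finset ℕ} {a : I → ℝ}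
    (ha : ∀ i, a i ∈ valueSubgroup v) {x : K} (hx : x ≠ 0) (ht : IsTropRoot a (trop v x)) :
    ∃ A : I → K, (∀ i, A i ≠ 0) ∧ (∀ i, trop v (A i) = a i) ∧
      ∑ i : I, A i * x ^ (i : ℕ) = 0 := by
  classical
  obtain ⟨i₁, i₂, hne, hmax⟩ := ht
  choose B hB0 hB using fun i => (mem_valueSubgroup_iff v).1 (ha i)
  have hterm0 : ∀ i : I, B i * x ^ (i : ℕ) ≠ 0 := fun i => mul_ne_zero (hB0 i) (pow_ne_zero _ hx)
  have hterm : ∀ i : I, trop v (B i * x ^ (i : ℕ)) = a i + (i : ℕ) * trop v x := fun i => by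
    rw [trop_mul v (hB0 i) (pow_ne_zero _ hx), trop_pow v hx, hB]
  set S := (Finset.univ.erase i₁).erase i₂ with hS
  obtain ⟨c, hc, hcv⟩ := exists_val_eq_val_mul_add v (y := B i₂ * x ^ (i₂ : ℕ))
    (s := ∑ i ∈ S, B i * x ^ (i : ℕ)) (AddValuation.map_le_sum v fun i _ => by
      rw [← trop_le_trop_iff v (hterm0 i) (hterm0 i₂), hterm, hterm]
      exact (hmax i).2)
  set y := c * (B i₂ * x ^ (i₂ : ℕ)) + ∑ i ∈ S, B i * x ^ (i : ℕ) with hy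
  have hc0 : c ≠ 0 := ne_zero_of_val v (r := 0) (by simpa using hc)
  have hct : trop v c = 0 := trop_eq_of_val v (by simpa using hc)
  rw [val_eq_coe v (hterm0 i₂)] at hcv
  have hy0 : y ≠ 0 := ne_zero_of_val v hcv
  have hyt : trop v y = a i₂ + (i₂ : ℕ) * trop v x := by rw [trop_eq_of_val v hcv, hterm]
  have hxi : (x ^ (i₁ : ℕ))⁻¹ ≠ 0 := inv_ne_zero (pow_ne_zero _ hx)
  let A : I → K := fun i =>
    if i = i₁ then -(y * (x ^ (i₁ : ℕ))⁻¹) else if i = i₂ then c * B i₂ else B i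
  have hA₁ : A i₁ = -(y * (x ^ (i₁ : ℕ))⁻¹) := if_pos rfl
  have hA₂ : A i₂ = c * B i₂ := by simp [A, hne.symm]
  have hA : ∀ i, i ≠ i₁ → i ≠ i₂ → A i = B i := fun i h h' => by simp [A, h, h']
  refine ⟨A, fun i => ?_, fun i => ?_, ?_⟩
  · by_cases h₁ : i = i₁
    · rw [h₁, hA₁]
      exact neg_ne_zero.2 (mul_ne_zero hy0 hxi)
    by_cases h₂ : i = i₂
    · rw [h₂, hA₂]
      exact mul_ne_zero hc0 (hB0 _)
    · rw [hA i h₁ h₂]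
      exact hB0 i
  · by_cases h₁ : i = i₁
    · rw [h₁, hA₁, trop_neg, trop_mul v hy0 hxi, trop_inv v (pow_ne_zero _ hx), trop_pow v hx, hyt]
      linarith [(hmax i₁).2, (hmax i₂).1]
    by_cases h₂ : i = i₂
    · rw [h₂, hA₂, trop_mul v hc0 (hB0 _), hct, hB, zero_add]
    · rw [hA i h₁ h₂, hB]
  · rw [← Finset.add_sum_erase _ _ (Finset.mem_univ i₁), ← Finset.add_sum_erase _ _
      (Finset.mem_erase.2 ⟨hne.symm, Finset.mem_univ i₂⟩), hA₁, hA₂]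
    have hsum : ∑ i ∈ S, A i * x ^ (i : ℕ) = ∑ i ∈ S, B i * x ^ (i : ℕ) := by
      refine Finset.sum_congr rfl fun i hi => ?_
      rw [hS, Finset.mem_erase, Finset.mem_erase] at hi
      rw [hA i hi.2.1 hi.1]
    rw [hsum, neg_mul, mul_assoc, inv_mul_cancel₀ (pow_ne_zero _ hx), hy]
    ring

end Lifting

/-! ### The tropical resultant -/

section Resultant

variable {K : Type*} [Field K] (v : AddValuation K (WithTop ℝ)) {p : ℕ} [CharP K p]
  {I J : Finset ℕ} {R : MvPolynomial (I ⊕ J) (ZMod p)}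

theorem IsResultant.eval_map_eq_zero_iff (hR : IsResultant K p I J R) {z : I ⊕ J → K}
    (hz : ∀ s, z s ≠ 0) :
    MvPolynomial.eval z (MvPolynomial.map (ZMod.castHom (dvd_refl p) K) R) = 0 ↔
      ∃ x : K, ∑ i : I, z (.inl i) * x ^ (i : ℕ) = 0 ∧ ∑ j : J, z (.inr j) * x ^ (j : ℕ) = 0 := by
  rw [MvPolynomial.eval_map, ← hR (fun i => z (.inl i)) (fun j => z (.inr j))
    (fun i _ => hz _) (fun j _ => hz _)]
  rw [show Sum.elim (fun i => z (.inl i)) (fun j => z (.inr j)) = z from Sum.elim_comp_inl_inr z]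

theorem IsResultant.trop_mem_commonRootLocus (hR : IsResultant K p I J R) (h0I : 0 ∈ I)
    (h0J : 0 ∈ J) {z : I ⊕ J → K} (hz : ∀ s, z s ≠ 0)
    (h : MvPolynomial.eval z (MvPolynomial.map (ZMod.castHom (dvd_refl p) K) R) = 0) :
    (fun s => trop v (z s)) ∈ commonRootLocus I J := by
  obtain ⟨x, h₁, h₂⟩ := (hR.eval_map_eq_zero_iff hz).1 h
  -- The constant coefficient is nonzero, so zero is not a root.
  have hx : x ≠ 0 := by
    rintro rfl
    rw [Finset.sum_eq_single ⟨0, h0I⟩] at h₁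
    · simp [hz] at h₁
    · intro i _ hi
      rw [zero_pow fun h => hi (Subtype.ext h), mul_zero]
    · simp
  exact ⟨trop v x, isTropRoot_of_root v h0I (fun i => hz _) hx h₁,
    isTropRoot_of_root v h0J (fun j => hz _) hx h₂⟩

/-- If the image vanished, all coefficient vectors would have a common tropical root. Coefficients
1, except for a `b_0` with positive tropicalization, refute this: the first polynomial has only the
tropical root 0, where `b_0` alone dominates the second. -/
theorem IsResultant.map_ne_zero [IsAlgClosed K] (hR : IsResultant K p I J R) (h0I : 0 ∈ I)
    (h0J : 0 ∈ J) (hv : ∃ x : K, x ≠ 0 ∧ v x ≠ 0) :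
    MvPolynomial.map (ZMod.castHom (dvd_refl p) K) R ≠ 0 := by
  classical
  intro hzero
  obtain ⟨γ, hγ0, hγ⟩ := (dense_valueSubgroup v hv).exists_between zero_lt_one
  obtain ⟨c, hc0, hc⟩ := (mem_valueSubgroup_iff v).1 hγ0
  have h := hR.trop_mem_commonRootLocus v h0I h0J
    (z := fun s => if s = .inr ⟨0, h0J⟩ then c else 1)
    (fun s => by split_ifs <;> simp [hc0]) (by rw [hzero, map_zero])
  obtain ⟨t, ⟨i₁, i₂, hi, h₁⟩, j₁, j₂, hj, h₂⟩ := h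
  simp only [reduceCtorEq, if_false, trop_one, zero_add] at h₁
  have ht : t = 0 := by
    have h3 : ((i₂ : ℕ) : ℝ) * t = (i₁ : ℕ) * t := le_antisymm (h₁ i₂).1 (h₁ i₁).2
    by_contra ht
    exact hi (Subtype.ext (by exact_mod_cast (mul_right_cancel₀ ht h3).symm))
  subst ht
  have h4 := h₂ ⟨0, h0J⟩
  simp only [mul_zero, add_zero, if_true, hc] at h4
  have hpos : ∀ j : J, γ ≤ trop v (if (Sum.inr j : I ⊕ J) = .inr ⟨0, h0J⟩ then c else 1) →
      j = ⟨0, h0J⟩ := by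
    intro j hle
    by_contra hne
    rw [if_neg fun h => hne (Sum.inr.inj h), trop_one] at hle
    exact absurd hle (not_le.2 hγ.1)
  exact hj ((hpos j₁ h4.1).trans (hpos j₂ h4.2).symm)

theorem IsResultant.zeros_valueGroup [IsAlgClosed K] (hR : IsResultant K p I J R) (h0I : 0 ∈ I)
    (h0J : 0 ∈ J) (hv : ∃ x : K, x ≠ 0 ∧ v x ≠ 0) :
    (tropicalResultant p v R).zeros (valueGroup v) =
      {w | w ∈ commonRootLocus I J ∧ ∀ s, w s ∈ valueGroup v} := by
  ext w
  constructor
  · intro hw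
    obtain ⟨z, hz, hzw, h⟩ := exists_eval_eq_zero_of_mem_zeros v hw
    obtain rfl : (fun s => trop v (z s)) = w := funext hzw
    exact ⟨hR.trop_mem_commonRootLocus v h0I h0J hz h, hw.1⟩
  · rintro ⟨⟨t, h₁, h₂⟩, hΓ⟩
    have ht : t ∈ valueSubgroup v := h₁.mem (fun _ => div_mem_valueSubgroup v) fun i => hΓ _
    obtain ⟨x, hx, rfl⟩ := (mem_valueSubgroup_iff v).1 ht
    obtain ⟨A, hA0, hA, hAx⟩ := exists_lift_of_isTropRoot v (fun i => hΓ _) hx h₁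
    obtain ⟨B, hB0, hB, hBx⟩ := exists_lift_of_isTropRoot v (fun j => hΓ _) hx h₂
    have hz : ∀ s, Sum.elim A B s ≠ 0 := by
      rintro (i | j)
      · exact hA0 i
      · exact hB0 j
    have hw : (fun s => trop v (Sum.elim A B s)) = w := by
      funext s
      cases s
      · exact hA _
      · exact hB _
    rw [← hw]
    exact trop_mem_zeros_of_eval_eq_zero v (hR.map_ne_zero v h0I h0J hv) hz
      ((hR.eval_map_eq_zero_iff hz).2 ⟨x, hAx, hBx⟩)

theorem IsResultant.closure_zeros_valueGroup [IsAlgClosed K] (hR : IsResultant K p I J R)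
    (h0I : 0 ∈ I) (h0J : 0 ∈ J) (hv : ∃ x : K, x ≠ 0 ∧ v x ≠ 0) :
    closure ((tropicalResultant p v R).zeros (valueGroup v)) = commonRootLocus I J := by
  rw [hR.zeros_valueGroup v h0I h0J hv]
  exact Set.Subset.antisymm
    ((isClosed_commonRootLocus I J).closure_subset_iff.2 fun w hw => hw.1)
    (commonRootLocus_subset_closure I J (Γ := valueSubgroup v) (dense_valueSubgroup v hv))

/-- The real points of the tropical resultant hypersurface. -/
theorem IsResultant.zeros_univ [IsAlgClosed K] (hR : IsResultant K p I J R) (h0I : 0 ∈ I)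
    (h0J : 0 ∈ J) (hv : ∃ x : K, x ≠ 0 ∧ v x ≠ 0) :
    (tropicalResultant p v R).zeros Set.univ = commonRootLocus I J := by
  rw [← hR.closure_zeros_valueGroup v h0I h0J hv]
  refine Set.Subset.antisymm ?_ ?_
  · refine TropPoly.zeros_univ_subset_closure _ (valueSubgroup v)
      (fun _ => div_mem_valueSubgroup v) (dense_valueSubgroup v hv) fun u hu => ?_
    exact (mem_valueSubgroup_iff v).2 ⟨_, MvPolynomial.mem_support_iff.1 hu, rfl⟩
  · exact (TropPoly.isClosed_zeros_univ _).closure_subset_iff.2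
      fun w hw => TropPoly.mem_zeros_univ.2 hw.2

theorem newtonPolytope_eq (R : MvPolynomial (I ⊕ J) (ZMod p)) : newtonPolytope R =
    convexHull ℝ (toReal '' ((tropicalResultant p v R).support : Set (I ⊕ J →₀ ℕ))) := by
  rw [newtonPolytope, tropicalResultant, tropicalize,
    MvPolynomial.support_map_of_injective _ (ZMod.castHom_injective K)]

end Resultant

end TropRes

open TropRes in
theorem mainTheorem8 {K : Type*} [Field K] [IsAlgClosed K] {K' : Type*} [Field K'] [IsAlgClosed K']
    (p p' : ℕ) [CharP K p] [CharP K' p']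
    (v : AddValuation K (WithTop ℝ)) (hv : ∃ x : K, x ≠ 0 ∧ v x ≠ 0)
    (v' : AddValuation K' (WithTop ℝ)) (hv' : ∃ x : K', x ≠ 0 ∧ v' x ≠ 0)
    (I J : Finset ℕ) (hI : 2 ≤ I.card) (hJ : 2 ≤ J.card) (h0I : 0 ∈ I) (h0J : 0 ∈ J)
    (R : MvPolynomial (I ⊕ J) (ZMod p)) (hR : IsResultant K p I J R)
    (R' : MvPolynomial (I ⊕ J) (ZMod p')) (hR' : IsResultant K' p' I J R') :
    -- the tropical hypersurface does not depend on the field, as a polyhedral complex and as a set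
    (tropicalResultant p v R).cells = (tropicalResultant p' v' R').cells ∧
    closure ((tropicalResultant p v R).zeros (valueGroup v)) =
      closure ((tropicalResultant p' v' R').zeros (valueGroup v')) ∧
    -- it is the fan dual to the Newton polytope of the resultant
    (∀ w, (tropicalResultant p v R).dualCell w = face (newtonPolytope R) w) ∧
    (tropicalResultant p v R).cells = dualFan (newtonPolytope R) ∧
    (tropicalResultant p v R).zeros (valueGroup v) =
      {w | w ∈ ⋃₀ dualFan (newtonPolytope R) ∧ ∀ s, w s ∈ valueGroup v} ∧
    closure ((tropicalResultant p v R).zeros (valueGroup v)) =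
      ⋃₀ dualFan (newtonPolytope R) := by
  have hz := hR.zeros_univ v h0I h0J hv
  have hz' := hR'.zeros_univ v' h0I h0J hv'
  have hne : (tropicalResultant p v R).support.Nonempty :=
    MvPolynomial.support_nonempty.2 (hR.map_ne_zero v h0I h0J hv)
  have hne' : (tropicalResultant p' v' R').support.Nonempty :=
    MvPolynomial.support_nonempty.2 (hR'.map_ne_zero v' h0I h0J hv')
  have hcone : ∀ t : ℝ, 0 < t → ∀ w ∈ (tropicalResultant p v R).zeros Set.univ,
      t • w ∈ (tropicalResultant p v R).zeros Set.univ := by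
    rw [hz]
    exact fun t ht w hw => smul_mem_commonRootLocus hw ht
  have hunion : ⋃₀ dualFan (newtonPolytope R) = commonRootLocus I J := by
    rw [newtonPolytope_eq v, TropPoly.sUnion_dualFan_eq hne hcone, hz]
  -- The two Newton polytopes are never compared; only the hypersurfaces are.
  refine ⟨TropPoly.cells_eq_of_zeros_eq hne hne' hcone (hz.trans hz'.symm), ?_, fun w => ?_, ?_, ?_,
    ?_⟩
  · rw [hR.closure_zeros_valueGroup v h0I h0J hv, hR'.closure_zeros_valueGroup v' h0I h0J hv']
  · rw [newtonPolytope_eq v, TropPoly.dualCell_eq_face hne hcone]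
  · rw [newtonPolytope_eq v, TropPoly.cells_eq_dualFan hne hcone]
  · rw [hunion, hR.zeros_valueGroup v h0I h0J hv]
  · rw [hunion, hR.closure_zeros_valueGroup v h0I h0J hv]
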